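/- Let $V(u)=(u^2-1)^2$, $\overline m(y)=\tanh y$ and $\overline m_z(y)=\overline m(y-z)$. For $\ell>0$ let $\mathcal X_\ell$ be the set of functions $m:\mathbb R\to\mathbb R$ with $m-\operatorname{sgn}\in L^2(\mathbb R)$ and $m=-1$ on $(-\infty,-\ell)$, and for $m\in\mathcal X_\ell$ let $$\mathcal F_\ell(m)=\int_{-\ell}^{+\infty}\big[(m')^2+V(m)\big]\,dy ,$$ where $\mathcal F_\ell(m)=+\infty$ if $m$ is not weakly differentiable, i.e. not locally absolutely continuous, on $\mathbb R$ (so finite energy forces $m(-\ell)=-1$; weakly differentiable functions are identified with their continuous representatives). For every $\ell>0$ and $z\in(-\ell,+\infty)$ the functional $\mathcal F_\ell$ has exactly one minimizer $m^\ell_z$ in $\{m\in\mathcal X_\ell:\ m(z)=0\}$. Write $[f](z)=\lim_{y\downarrow z}f(y)-\lim_{y\uparrow z}f(y)$ for the jump of $f$ at $z$. There exists a constant $A>0$ such that the following hold. For all $\ell>0$ and $z\in\mathbb R$ with $\ell+z\ge 1$, the map $w\mapsto m^\ell_w(y)$ is twice differentiable at $w=z$ for each $y\in(-\ell,z)$,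 and $$\sup_{y\in(-\ell,z)}\big|m^\ell_z(y)-\overline m_z(y)\big|\le Ae^{-2(\ell+z)},$$ $$\sup_{y\in(-\ell,z)}\big|\partial_z m^\ell_z(y)+\overline m_z'(y)\big|\le Ae^{-2(\ell+z)},$$ $$\sup_{y\in(-\ell,z)}\big|\partial_{zz} m^\ell_z(y)-\overline m_z''(y)\big|\le Ae^{-2(\ell+z)};$$ moreover the derivatives $(m^\ell_z)'(y)$ and $\partial_z m^\ell_z(y)$ exist for all $y>-\ell$, $y\ne z$, have one-sided limits as $y\to z$, and $$\big[(m^\ell_z)'\big](z)+\big[\partial_z m^\ell_z\big](z)=0,\qquad \big|\big[(m^\ell_z)'\big](z)\big|\le Ae^{-4(\ell+z)}.$$ Finally, for all $\ell>0$ and $z_1,z_2\in\mathbb R$ with $\min(z_1+\ell,z_2+\ell)\ge 1$ one has $m^\ell_{z_1}-m^\ell_{z_2}\in L^2(\mathbb R)$ and $$\frac1A\min\big(|z_1-z_2|^2,|z_1-z_2|\big)\le\big\|m^\ell_{z_1}-m^\ell_{z_2}\big\|_{L^2(\mathbb R)}^2\le A\min\big(|z_1-z_2|^2,|z_1-z_2|\big).$$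 -/

import Mathlib

open Set Filter Topology MeasureTheory
open scoped ENNReal

/-- The symmetric double well potential `V(u) = (u² - 1)²`. -/
def doubleWell (u : ℝ) : ℝ := (u ^ 2 - 1) ^ 2

/-- The translated instanton `m̄_z(y) = tanh (y - z)`. -/
noncomputable def instanton (z y : ℝ) : ℝ := Real.tanh (y - z)

/-- The space `𝒳_ℓ` of the functions `m` on the line with `m - sgn ∈ L²(ℝ)` and `m = -1` on
`(-∞, -ℓ)`. -/
def profileSpace (ℓ : ℝ) : Set (ℝ → ℝ) :=
  {m | MemLp (fun y => m y - Real.sign y) 2 volume ∧ ∀ y < -ℓ, m y = -1}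

/-- `m` is locally absolutely continuous on the whole line, i.e. it is the continuous representative
of a function that has a locally integrable weak derivative (namely `deriv m`, which exists almost
everywhere). -/
def IsLocallyAC (m : ℝ → ℝ) : Prop :=
  ∀ a b : ℝ, AbsolutelyContinuousOnInterval m a b

open scoped Classical in
/-- The energy `ℱ_ℓ(m) = ∫_{-ℓ}^∞ ((m')² + V(m)) dy`, set equal to `+∞` when `m ∉ 𝒳_ℓ` or `m` is
not (the continuous representative of) a weakly differentiable function on the line. Since local
absolute continuity is required on all of `ℝ`, a function in `𝒳_ℓ` of finite energy satisfies the
boundary condition `m(-ℓ) = -1`. -/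
noncomputable def profileEnergy (ℓ : ℝ) (m : ℝ → ℝ) : ℝ≥0∞ :=
  if m ∈ profileSpace ℓ ∧ IsLocallyAC m then
    ∫⁻ y in Ioi (-ℓ), ENNReal.ofReal ((deriv m y) ^ 2 + doubleWell (m y))
  else ⊤

/-- `m` minimizes `ℱ_ℓ` among the functions of `𝒳_ℓ` that vanish at `z`. -/
def IsConstrainedMinimizer (ℓ z : ℝ) (m : ℝ → ℝ) : Prop :=
  (m ∈ profileSpace ℓ ∧ m z = 0) ∧
    ∀ n ∈ profileSpace ℓ, n z = 0 → profileEnergy ℓ m ≤ profileEnergy ℓ n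

/-- The constrained minimizer `m^ℓ_z`, as a function on the line. -/
noncomputable def constrainedMin (ℓ z : ℝ) : ℝ → ℝ :=
  Classical.epsilon fun m => IsConstrainedMinimizer ℓ z m

/-- `f` has one-sided limits at `z`, and its jump `[f](z) = f(z⁺) - f(z⁻)` is equal to `j`. -/
def HasJump (f : ℝ → ℝ) (z j : ℝ) : Prop :=
  ∃ l r : ℝ, Tendsto f (𝓝[<] z) (𝓝 l) ∧ Tendsto f (𝓝[>] z) (𝓝 r) ∧ j = r - l

/-- `f` is twice differentiable at `x`: it is differentiable in a neighbourhood of `x` and its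
derivative is differentiable at `x`. -/
def TwiceDifferentiableAt (f : ℝ → ℝ) (x : ℝ) : Prop :=
  (∀ᶠ w in 𝓝 x, DifferentiableAt ℝ f w) ∧ DifferentiableAt ℝ (deriv f) x

/-! The minimizer is explicit. With `L = ℓ + z`, choose the energy `e^θ` so that the orbit of `u' =
√(V(u) + e^θ)` needs exactly the time `L` from `0` to `1`. Reflected, this orbit joins `-1` at the
wall to `0` at `z`; to the right of `z` the profile is the instanton. Minimality is a calibration:
completing the square with the speed `w` of the orbit writes the energy as a constant fixed by the
boundary values plus `∫ (m' - w(m))²`, and similarly on the right with `w(u) = 1 - u²`. The profile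
makes both squares vanish, and any other minimizer must solve the same first-order equations
(`integral_energyDensity`, `IsConstrainedMinimizer.eq_wallProfile`).

The quantitative part rests on `ε = e^(θ/2) = O(e^(-2L))` (`exp_half_level_le`), a logarithmic
estimate of the travel time near the well. The heights of the orbit and of the instanton differ by
at most `ε`. The derivatives in `z` come from implicit differentiation of the travel time, and their
errors are controlled by comparing the speed at height `u` with `D = 1 - u + ε`. The jump is `1 -
√(1 + ε²)`, hence quadratic in `ε`.

For the `L²` bounds, monotonicity of the travel time in the energy traps `m_{z₂}` between `m_{z₁}`
and its translate by `z₂ - z₁ ≥ 0`. The integral of the gap between these is at most twice the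
shift. The lower bound only uses the explicit part of the profiles to the right of `z₁`. -/

/-! ### Speed and travel time: smooth dependence on energy and height. -/

/-- The speed `√(V(s) + e^θ)` of the orbit of energy `e^θ` at height `s`. -/
noncomputable def speed (θ s : ℝ) : ℝ := √(doubleWell s + Real.exp θ)

lemma doubleWell_nonneg (s : ℝ) : 0 ≤ doubleWell s := sq_nonneg _

lemma speed_sq (θ s : ℝ) : speed θ s ^ 2 = (1 - s ^ 2) ^ 2 + Real.exp θ := by
  rw [speed, Real.sq_sqrt (by have := doubleWell_nonneg s; positivity), doubleWell]; ring

lemma speed_pos (θ s : ℝ) : 0 < speed θ s :=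
  Real.sqrt_pos.2 (by have := doubleWell_nonneg s; positivity)

lemma speed_neg (θ s : ℝ) : speed θ (-s) = speed θ s := by simp [speed, doubleWell]

lemma continuous_speed : Continuous fun p : ℝ × ℝ => speed p.1 p.2 := by
  unfold speed doubleWell; fun_prop

@[fun_prop]
lemma continuous_speed_comp {X : Type*} [TopologicalSpace X] {f g : X → ℝ} (hf : Continuous f)
    (hg : Continuous g) : Continuous fun x => speed (f x) (g x) :=
  continuous_speed.comp (hf.prodMk hg)

lemma hasDerivAt_speed_comp {f g : ℝ → ℝ} {f' g' x : ℝ} (hf : HasDerivAt f f' x)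
    (hg : HasDerivAt g g' x) :
    HasDerivAt (fun w => speed (f w) (g w))
      ((-4 * g x * (1 - g x ^ 2) * g' + Real.exp (f x) * f') / (2 * speed (f x) (g x))) x := by
  have h : HasDerivAt (fun w => doubleWell (g w) + Real.exp (f w))
      (-4 * g x * (1 - g x ^ 2) * g' + Real.exp (f x) * f') x := by
    unfold doubleWell
    convert! (((hg.pow 2).sub_const 1).pow 2).add hf.exp using 1
    simp; ring
  exact h.sqrt (by have := doubleWell_nonneg (g x); positivity)

/-- The integral of `speed ^ (-k)` from `0` to `u`; for `k = 1` this is the time at which the orbit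
of energy `e^θ` started at `0` reaches the height `u`. -/
noncomputable def travel (k : ℕ) (θ u : ℝ) : ℝ := ∫ s in (0 : ℝ)..u, (speed θ s ^ k)⁻¹

@[fun_prop]
lemma continuous_speed_pow_inv {X : Type*} [TopologicalSpace X] {f g : X → ℝ} (hf : Continuous f)
    (hg : Continuous g) (k : ℕ) : Continuous fun x => (speed (f x) (g x) ^ k)⁻¹ :=
  ((continuous_speed_comp hf hg).pow k).inv₀ fun _ => (pow_pos (speed_pos _ _) _).ne'

lemma speed_pow_inv_intervalIntegrable (k : ℕ) (θ a b : ℝ) :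
    IntervalIntegrable (fun s => (speed θ s ^ k)⁻¹) volume a b :=
  (continuous_speed_pow_inv continuous_const continuous_id k).intervalIntegrable _ _

@[simp] lemma travel_zero (k : ℕ) (θ : ℝ) : travel k θ 0 = 0 := by simp [travel]

@[fun_prop]
lemma continuous_travel {X : Type*} [TopologicalSpace X] [FirstCountableTopology X] {f g : X → ℝ}
    (hf : Continuous f) (hg : Continuous g) (k : ℕ) : Continuous fun x => travel k (f x) (g x) := by
  have h : Continuous fun p : ℝ × ℝ => travel k p.1 p.2 := by
    unfold travel
    exact intervalIntegral.continuous_parametric_primitive_of_continuous (μ := volume) (a₀ := 0)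
      (f := fun θ s => (speed θ s ^ k)⁻¹) (continuous_speed_pow_inv continuous_fst continuous_snd k)
  exact h.comp (hf.prodMk hg)

lemma hasDerivAt_travel_right (k : ℕ) (θ u : ℝ) :
    HasDerivAt (travel k θ) (speed θ u ^ k)⁻¹ u := by
  have hc : Continuous fun s => (speed θ s ^ k)⁻¹ := continuous_speed_pow_inv continuous_const continuous_id k
  exact intervalIntegral.integral_hasDerivAt_right (hc.intervalIntegrable _ _)
    (hc.stronglyMeasurableAtFilter _ _) hc.continuousAt

/-- Differentiation in `θ` raises the exponent by two, so the first two derivatives of the travel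
time involve only `travel` with indices `1`, `3`, `5`. -/
lemma hasDerivAt_speed_pow_inv (k : ℕ) (θ s : ℝ) :
    HasDerivAt (fun t => (speed t s ^ k)⁻¹)
      (-(k / 2 * Real.exp θ) * (speed θ s ^ (k + 2))⁻¹) θ := by
  have h := (hasDerivAt_speed_comp (hasDerivAt_id θ) (hasDerivAt_const θ s)).pow k
  have h0 := (speed_pos θ s).ne'
  convert! h.inv (pow_ne_zero k h0) using 1
  rcases k with _ | k
  · simp
  · simp
    field_simp
    ring

lemma hasDerivAt_travel_left (k : ℕ) (θ u : ℝ) :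
    HasDerivAt (fun t => travel k t u) (-(k / 2 * Real.exp θ) * travel (k + 2) θ u) θ := by
  unfold travel
  rw [← intervalIntegral.integral_const_mul]
  obtain ⟨M, hM⟩ := ((isCompact_Icc (a := θ - 1) (b := θ + 1)).prod
    (isCompact_uIcc (a := 0) (b := u))).exists_bound_of_continuousOn
    (f := fun p : ℝ × ℝ => -(k / 2 * Real.exp p.1) * (speed p.1 p.2 ^ (k + 2))⁻¹)
    (by
      refine Continuous.continuousOn (.mul (by fun_prop) ?_)
      exact continuous_speed_pow_inv continuous_fst continuous_snd _)
  have hm (θ : ℝ) (j : ℕ) (v : ℝ) : AEStronglyMeasurable (fun s => v * (speed θ s ^ j)⁻¹)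
      (volume.restrict (uIoc 0 u)) := by
    exact (continuous_const.mul
      (continuous_speed_pow_inv continuous_const continuous_id j)).aestronglyMeasurable
  refine (intervalIntegral.hasDerivAt_integral_of_dominated_loc_of_deriv_le
    (F' := fun t s => -(k / 2 * Real.exp t) * (speed t s ^ (k + 2))⁻¹)
    (bound := fun _ => M) (s := Icc (θ - 1) (θ + 1)) (Icc_mem_nhds (sub_one_lt θ) (lt_add_one θ))
    (Eventually.of_forall fun t => by simpa using hm t k 1)
    (speed_pow_inv_intervalIntegrable _ _ _ _) (hm _ _ _) ?_ (by simp) ?_).2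
  · exact Eventually.of_forall fun s hs t ht => hM (t, s) ⟨ht, uIoc_subset_uIcc hs⟩
  · exact Eventually.of_forall fun s _ t _ => hasDerivAt_speed_pow_inv k t s

/-- Both partial derivatives are jointly continuous; strictness is what the implicit function
theorem needs. -/
lemma hasStrictFDerivAt_travel (k : ℕ) (p : ℝ × ℝ) :
    HasStrictFDerivAt (fun p : ℝ × ℝ => travel k p.1 p.2)
      ((ContinuousLinearMap.toSpanSingleton ℝ
          (-(k / 2 * Real.exp p.1) * travel (k + 2) p.1 p.2)).coprod
        (ContinuousLinearMap.toSpanSingleton ℝ (speed p.1 p.2 ^ k)⁻¹)) p := by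
  refine hasStrictFDerivAt_uncurry_coprod (f := travel k)
    (f₁ := fun θ u => ContinuousLinearMap.toSpanSingleton ℝ
          (-(k / 2 * Real.exp θ) * travel (k + 2) θ u))
    (f₂ := fun θ u => ContinuousLinearMap.toSpanSingleton ℝ (speed θ u ^ k)⁻¹)
    (Eventually.of_forall fun v => (hasDerivAt_travel_left k v.1 v.2).hasFDerivAt)
    (Eventually.of_forall fun v => (hasDerivAt_travel_right k v.1 v.2).hasFDerivAt) ?_ ?_
  · exact ((ContinuousLinearMap.toSpanSingletonCLE (𝕜 := ℝ) (E := ℝ)).continuous.comp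
      (.mul (by fun_prop) (continuous_travel continuous_fst continuous_snd _))).continuousAt
  · exact ((ContinuousLinearMap.toSpanSingletonCLE (𝕜 := ℝ) (E := ℝ)).continuous.comp
      (continuous_speed_pow_inv continuous_fst continuous_snd k)).continuousAt

lemma hasDerivAt_travel_comp {k : ℕ} {f g : ℝ → ℝ} {f' g' x : ℝ} (hf : HasDerivAt f f' x)
    (hg : HasDerivAt g g' x) :
    HasDerivAt (fun w => travel k (f w) (g w))
      (-(k / 2 * Real.exp (f x)) * travel (k + 2) (f x) (g x) * f' +
        (speed (f x) (g x) ^ k)⁻¹ * g') x := by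
  have := (hasStrictFDerivAt_travel k (f x, g x)).hasFDerivAt.comp_hasDerivAt x (hf.prodMk hg)
  convert! this using 1
  simp; ring

/-! ### Calculus tools: implicit functions, comparison of increments, `tanh` and `artanh`. -/

/-- A scalar implicit function theorem for a globally defined implicit function. -/
lemma differentiableAt_of_implicit {f : ℝ × ℝ → ℝ} {f' : ℝ × ℝ →L[ℝ] ℝ} {g : ℝ → ℝ} {x : ℝ}
    (hf : HasStrictFDerivAt f f' (x, g x)) (hf' : f' (0, 1) ≠ 0)
    (hg : ∀ᶠ w in 𝓝 x, ∀ n, f (w, n) = f (x, g x) → g w = n) : DifferentiableAt ℝ g x := by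
  have hinv : (f' ∘L .inr ℝ ℝ ℝ).IsInvertible := by
    refine ⟨ContinuousLinearEquiv.unitsEquivAut ℝ (Units.mk0 _ hf'), ?_⟩
    ext; simp
  have h1 := hf.hasStrictFDerivAt_implicitFunctionOfProdDomain hinv
  have h2 := hf.eventually_apply_implicitFunctionOfProdDomain hinv
  refine h1.hasFDerivAt.differentiableAt.congr_of_eventuallyEq ?_
  filter_upwards [hg, h2] with w h3 h4 using h3 _ h4

lemma sub_le_sub_of_hasDerivAt_le {f g f' g' : ℝ → ℝ} {a b : ℝ} (hab : a ≤ b)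
    (hf : ∀ x ∈ Icc a b, HasDerivAt f (f' x) x) (hg : ∀ x ∈ Icc a b, HasDerivAt g (g' x) x)
    (h : ∀ x ∈ Icc a b, f' x ≤ g' x) : f b - f a ≤ g b - g a := by
  have hd (x) (hx : x ∈ Icc a b) := (hg x hx).sub (hf x hx)
  have : MonotoneOn (g - f) (Icc a b) := by
    refine monotoneOn_of_hasDerivWithinAt_nonneg (f' := g' - f') (convex_Icc a b)
      (fun x hx => (hd x hx).continuousAt.continuousWithinAt)
      (fun x hx => (hd x (interior_subset hx)).hasDerivWithinAt)
      (fun x hx => sub_nonneg.2 (h x (interior_subset hx)))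
  have := this (left_mem_Icc.2 hab) (right_mem_Icc.2 hab) hab
  simp only [Pi.sub_apply] at this
  linarith

lemma hasDerivAt_tanh (x : ℝ) : HasDerivAt Real.tanh (1 - Real.tanh x ^ 2) x := by
  have hc := (Real.cosh_pos x).ne'
  have h := (Real.hasDerivAt_sinh x).div (Real.hasDerivAt_cosh x) hc
  have he : Real.tanh = Real.sinh / Real.cosh := funext Real.tanh_eq_sinh_div_cosh
  rw [he]
  convert! h using 1
  simp only [Pi.div_apply]
  field_simp

lemma continuous_tanh : Continuous Real.tanh :=
  continuous_iff_continuousAt.2 fun x => (hasDerivAt_tanh x).continuousAt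

lemma tanh_strictMono : StrictMono Real.tanh := by
  refine strictMono_of_hasDerivAt_pos hasDerivAt_tanh fun x => ?_
  have := Real.tanh_sq_lt_one x
  linarith

lemma tanh_nonneg {x : ℝ} (hx : 0 ≤ x) : 0 ≤ Real.tanh x := by
  simpa using tanh_strictMono.monotone hx

lemma hasDerivAt_artanh {x : ℝ} (hx : x ∈ Ioo (-1) 1) :
    HasDerivAt Real.artanh (1 - x ^ 2)⁻¹ x := by
  have hx2 : 1 - Real.tanh (Real.artanh x) ^ 2 ≠ 0 := by
    have := Real.tanh_sq_lt_one (Real.artanh x); linarith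
  have hs : HasStrictDerivAt Real.tanh (1 - Real.tanh (Real.artanh x) ^ 2) (Real.artanh x) := by
    refine hasStrictDerivAt_of_hasDerivAt_of_continuousAt
      (Eventually.of_forall hasDerivAt_tanh) ?_
    exact (continuous_const.sub (continuous_tanh.pow 2)).continuousAt
  have := (hs.to_local_left_inverse hx2 (Eventually.of_forall Real.artanh_tanh)).hasDerivAt
  rwa [Real.tanh_artanh hx] at this

/-! ### Comparison of the travel time with that of the instanton. -/

lemma exp_half_sq (θ : ℝ) : Real.exp (θ / 2) ^ 2 = Real.exp θ := by
  rw [← Real.exp_nat_mul]; congr 1; push_cast; ring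

lemma one_sub_sq_le_speed (θ s : ℝ) : 1 - s ^ 2 ≤ speed θ s := by
  have := Real.exp_pos θ
  exact Real.le_sqrt_of_sq_le (by unfold doubleWell; nlinarith)

lemma exp_half_le_speed (θ s : ℝ) : Real.exp (θ / 2) ≤ speed θ s := by
  have := doubleWell_nonneg s
  exact Real.le_sqrt_of_sq_le (by rw [exp_half_sq]; linarith)

lemma speed_le_add {θ s : ℝ} (hs : s ^ 2 ≤ 1) : speed θ s ≤ 1 - s ^ 2 + Real.exp (θ / 2) := by
  have := Real.exp_pos (θ / 2)
  refine abs_le_of_sq_le_sq' ?_ (by nlinarith) |>.2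
  rw [speed_sq, ← exp_half_sq]
  nlinarith

lemma travel_nonneg (k : ℕ) (θ : ℝ) {u : ℝ} (hu : 0 ≤ u) : 0 ≤ travel k θ u :=
  intervalIntegral.integral_nonneg hu fun s _ => (inv_pos.2 (pow_pos (speed_pos θ s) k)).le

lemma travel_strictMono (k : ℕ) (θ : ℝ) : StrictMono (travel k θ) :=
  strictMono_of_hasDerivAt_pos (hasDerivAt_travel_right k θ)
    fun u => inv_pos.2 (pow_pos (speed_pos θ u) k)

lemma travel_pos (k : ℕ) (θ : ℝ) {u : ℝ} (hu : 0 < u) : 0 < travel k θ u := by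
  simpa using travel_strictMono k θ hu

lemma travel_one_strictAnti {u : ℝ} (hu : 0 < u) : StrictAnti fun θ => travel 1 θ u := by
  refine strictAnti_of_hasDerivAt_neg (fun θ => hasDerivAt_travel_left 1 θ u) fun θ => ?_
  have := mul_pos (Real.exp_pos θ) (travel_pos 3 θ hu)
  push_cast
  linarith

/-- At zero energy the travel time is `artanh u`; positive energy shortens it. -/
lemma tanh_travel_le (θ : ℝ) {u : ℝ} (h0 : 0 ≤ u) (h1 : u ≤ 1) :
    Real.tanh (travel 1 θ u) ≤ u := by
  rcases h1.eq_or_lt with rfl | h1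
  · exact (Real.tanh_lt_one _).le
  have := sub_le_sub_of_hasDerivAt_le h0 (fun x _ => hasDerivAt_travel_right 1 θ x)
    (fun x hx => hasDerivAt_artanh (x := x) ⟨by linarith [hx.1], by linarith [hx.2]⟩)
    (fun x hx => by
      rw [pow_one]
      exact inv_anti₀ (by nlinarith [hx.1, hx.2]) (one_sub_sq_le_speed θ x))
  simp only [travel_zero, Real.artanh_zero, sub_zero] at this
  simpa [Real.tanh_artanh (x := u) ⟨by linarith, h1⟩] using tanh_strictMono.monotone this

/-- With `a = 1 + ε`, the speed is at most `1 - x² + ε ≤ (a² - x²) / a`, and the right-hand side is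
the reciprocal of the derivative of `artanh (x / a)`. -/
lemma le_mul_tanh_travel (θ : ℝ) {u : ℝ} (h0 : 0 ≤ u) (h1 : u ≤ 1) :
    u ≤ (1 + Real.exp (θ / 2)) * Real.tanh (travel 1 θ u) := by
  have he := Real.exp_pos (θ / 2)
  set a := 1 + Real.exp (θ / 2) with ha
  have ha0 : a ≠ 0 := by linarith
  have hmem (x) (hx : x ∈ Icc 0 u) : x / a ∈ Ioo (-1) 1 :=
    ⟨by have := div_nonneg hx.1 (by linarith : 0 ≤ a); linarith,
      (div_lt_one (by linarith)).2 (by linarith [hx.2])⟩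
  have := sub_le_sub_of_hasDerivAt_le h0
    (fun x hx => (hasDerivAt_artanh (hmem x hx)).comp x ((hasDerivAt_id x).div_const a))
    (fun x _ => hasDerivAt_travel_right 1 θ x)
    (fun x hx => by
      have hx1 : x ^ 2 ≤ 1 := by nlinarith [hx.1, hx.2]
      have hs := speed_le_add (θ := θ) hx1
      have hp := speed_pos θ x
      rw [pow_one, one_div, ← mul_inv]
      refine inv_anti₀ hp ?_
      have : (1 - (x / a) ^ 2) * a = (a ^ 2 - x ^ 2) / a := by
        field_simp
      rw [this, le_div_iff₀ (by linarith)]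
      calc speed θ x * a ≤ (1 - x ^ 2 + Real.exp (θ / 2)) * a := by gcongr
        _ ≤ a ^ 2 - x ^ 2 := by rw [ha]; nlinarith [sq_nonneg x])
  simp only [travel_zero, Function.comp, id, zero_div, Real.artanh_zero, sub_zero] at this
  have := tanh_strictMono.monotone this
  rw [Real.tanh_artanh (hmem u ⟨h0, le_rfl⟩), div_le_iff₀ (by linarith)] at this
  linarith

lemma travel_one_le (θ : ℝ) : travel 1 θ 1 ≤ Real.exp (-(θ / 2)) := by
  have := sub_le_sub_of_hasDerivAt_le zero_le_one (fun x _ => hasDerivAt_travel_right 1 θ x)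
    (fun x _ => (hasDerivAt_id x).mul_const (Real.exp (-(θ / 2))))
    (fun x _ => by
      rw [pow_one, one_mul, Real.exp_neg]
      exact inv_anti₀ (Real.exp_pos _) (exp_half_le_speed θ x))
  simpa using this

lemma exists_travel_one_eq {L : ℝ} (hL : 0 < L) : ∃ θ, travel 1 θ 1 = L := by
  have hc : Continuous fun θ => travel 1 θ 1 := continuous_travel continuous_id continuous_const 1
  -- The choice `ε = 1 / L` makes the time at most `L`; the choice `1 + ε = 1 / tanh L` makes it at
  -- least `L`.
  refine mem_range_of_exists_le_of_exists_ge hc ⟨-2 * Real.log L, ?_⟩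
    ⟨2 * Real.log ((Real.tanh L)⁻¹ - 1), ?_⟩
  · refine (travel_one_le _).trans_eq ?_
    rw [show -(-2 * Real.log L / 2) = Real.log L by ring, Real.exp_log hL]
  · have h0 : 0 < Real.tanh L := by simpa using tanh_strictMono hL
    have h1 := Real.tanh_lt_one L
    have h2 : 0 < (Real.tanh L)⁻¹ - 1 := sub_pos.2 ((one_lt_inv₀ h0).2 h1)
    have := le_mul_tanh_travel (2 * Real.log ((Real.tanh L)⁻¹ - 1)) zero_le_one le_rfl
    rw [mul_div_cancel_left₀ _ two_ne_zero, Real.exp_log h2, add_sub_cancel, inv_mul_eq_div,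
      one_le_div h0] at this
    exact tanh_strictMono.le_iff_le.1 this

/-! ### The energy level determined by the distance to the wall, and its orbit. -/

/-- The logarithm of the energy of the orbit that needs the time `L` from `0` to `1`. -/
noncomputable def level (L : ℝ) : ℝ := Classical.epsilon fun θ => travel 1 θ 1 = L

/-- The orbit of energy `e^θ` started at `0`. -/
noncomputable def orbit (θ : ℝ) : ℝ → ℝ := Function.invFun (travel 1 θ)

lemma travel_level {L : ℝ} (hL : 0 < L) : travel 1 (level L) 1 = L :=
  Classical.epsilon_spec (exists_travel_one_eq hL)

lemma level_travel (θ : ℝ) : level (travel 1 θ 1) = θ :=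
  (travel_one_strictAnti one_pos).injective (travel_level (travel_pos 1 θ one_pos))

lemma level_anti {L L' : ℝ} (hL : 0 < L) (h : L ≤ L') : level L' ≤ level L := by
  refine (travel_one_strictAnti one_pos).le_iff_ge.1 ?_
  simpa only [travel_level hL, travel_level (hL.trans_le h)]

@[simp] lemma orbit_travel (θ u : ℝ) : orbit θ (travel 1 θ u) = u :=
  Function.leftInverse_invFun (travel_strictMono 1 θ).injective u

@[simp] lemma orbit_zero (θ : ℝ) : orbit θ 0 = 0 := by simpa using orbit_travel θ 0

lemma exists_eq_travel {θ t : ℝ} (ht : t ∈ Icc 0 (travel 1 θ 1)) :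
    ∃ u ∈ Icc (0 : ℝ) 1, travel 1 θ u = t := by
  have hc : Continuous (travel 1 θ) := continuous_travel continuous_const continuous_id 1
  have := intermediate_value_Icc zero_le_one hc.continuousOn
  rw [travel_zero] at this
  exact this ht

lemma travel_orbit {θ t : ℝ} (ht : t ∈ Icc 0 (travel 1 θ 1)) : travel 1 θ (orbit θ t) = t := by
  obtain ⟨u, -, rfl⟩ := exists_eq_travel ht
  rw [orbit_travel]

lemma orbit_mem {θ t : ℝ} (ht : t ∈ Icc 0 (travel 1 θ 1)) : orbit θ t ∈ Icc (0 : ℝ) 1 := by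
  obtain ⟨u, hu, rfl⟩ := exists_eq_travel ht
  rwa [orbit_travel]

lemma orbit_level {L : ℝ} (hL : 0 < L) : orbit (level L) L = 1 := by
  have := orbit_travel (level L) 1
  rwa [travel_level hL] at this

/-- The speed stays positive beyond the heights `0` and `1`, so the derivative is two-sided even at
the endpoints of the time interval. -/
lemma hasDerivAt_orbit {θ t : ℝ} (ht : t ∈ Icc 0 (travel 1 θ 1)) :
    HasDerivAt (orbit θ) (speed θ (orbit θ t)) t := by
  obtain ⟨u, -, rfl⟩ := exists_eq_travel ht
  rw [orbit_travel]
  have hs : HasStrictDerivAt (travel 1 θ) (speed θ u ^ 1)⁻¹ u :=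
    hasStrictDerivAt_of_hasDerivAt_of_continuousAt
      (Eventually.of_forall (hasDerivAt_travel_right 1 θ))
      (continuous_speed_pow_inv continuous_const continuous_id 1).continuousAt
  have := (hs.to_local_left_inverse (inv_ne_zero (pow_ne_zero _ (speed_pos θ u).ne'))
    (Eventually.of_forall (orbit_travel θ))).hasDerivAt
  rwa [pow_one, inv_inv] at this

lemma hasStrictDerivAt_level {L : ℝ} (hL : 0 < L) :
    HasStrictDerivAt level (-2 / (Real.exp (level L) * travel 3 (level L) 1)) L := by
  set θ := level L with hθ
  have hs : HasStrictDerivAt (fun θ => travel 1 θ 1)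
      (-((1 : ℕ) / 2 * Real.exp θ) * travel (1 + 2) θ 1) θ :=
    hasStrictDerivAt_of_hasDerivAt_of_continuousAt
      (Eventually.of_forall fun θ => hasDerivAt_travel_left 1 θ 1)
      (.mul (by fun_prop) (continuous_travel continuous_id continuous_const _).continuousAt)
  have h3 := travel_pos 3 θ one_pos
  have he := Real.exp_pos θ
  have := hs.to_local_left_inverse (by norm_num; exact h3.ne')
    (Eventually.of_forall level_travel)
  rw [hθ, travel_level hL, ← hθ] at this
  refine this.congr_deriv ?_
  norm_num
  ring

/-! ### Derivatives of the orbit in the position of the zero. -/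

section WallOrbit

variable {ℓ y z : ℝ}

/-- The factor that the adjustment of the energy to the position of the wall contributes to the
derivative of the height of the orbit with respect to the position of the zero. -/
noncomputable def wallFactor (θ u : ℝ) : ℝ := 1 - travel 3 θ u / travel 3 θ 1

lemma travel_orbit_level (hy : -ℓ < y) (hz : y < z) :
    travel 1 (level (ℓ + z)) (orbit (level (ℓ + z)) (z - y)) = z - y :=
  travel_orbit ⟨by linarith, by rw [travel_level (by linarith)]; linarith⟩

/-- The height `n` solves `travel 1 (level (ℓ + w)) n - w = -y`, whose derivative in `n` is the
reciprocal of the speed and hence nonzero. -/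
lemma differentiableAt_orbit_level (hy : -ℓ < y) (hz : y < z) :
    DifferentiableAt ℝ (fun w => orbit (level (ℓ + w)) (w - y)) z := by
  have hl : HasStrictFDerivAt (fun p : ℝ × ℝ => level (ℓ + p.1)) _
      (z, orbit (level (ℓ + z)) (z - y)) :=
    (hasStrictDerivAt_level (L := ℓ + z) (by linarith)).hasStrictFDerivAt.comp
      (z, orbit (level (ℓ + z)) (z - y)) (hasStrictFDerivAt_fst.const_add ℓ)
  have hf := ((hasStrictFDerivAt_travel 1 (level (ℓ + z), orbit (level (ℓ + z)) (z - y))).comp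
    (z, orbit (level (ℓ + z)) (z - y)) (hl.prodMk hasStrictFDerivAt_snd)).sub hasStrictFDerivAt_fst
  refine differentiableAt_of_implicit hf ?_ ?_
  · simpa using (speed_pos _ _).ne'
  · filter_upwards [lt_mem_nhds hz] with w hw n hn
    have : travel 1 (level (ℓ + w)) n = w - y := by
      have := travel_orbit_level hy hz
      simp only [Pi.sub_apply, this] at hn
      linarith
    rw [← this, orbit_travel]

lemma hasDerivAt_level (hz : -ℓ < z) : HasDerivAt (fun w => level (ℓ + w))
    (-2 / (Real.exp (level (ℓ + z)) * travel 3 (level (ℓ + z)) 1)) z := by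
  simpa using (hasStrictDerivAt_level (L := ℓ + z) (by linarith)).hasDerivAt.comp_const_add ℓ z

/-- Once differentiability is known, differentiating the identity `travel = w - y` gives the value;
the factor `e^θ` cancels against the one in the derivative of `level`. -/
lemma hasDerivAt_orbit_level (hy : -ℓ < y) (hz : y < z) :
    HasDerivAt (fun w => orbit (level (ℓ + w)) (w - y))
      (speed (level (ℓ + z)) (orbit (level (ℓ + z)) (z - y)) *
        wallFactor (level (ℓ + z)) (orbit (level (ℓ + z)) (z - y))) z := by
  have hN := (differentiableAt_orbit_level hy hz).hasDerivAt
  have h1 := hasDerivAt_travel_comp (k := 1) (hasDerivAt_level (hy.trans hz)) hN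
  have h2 : HasDerivAt (fun w => travel 1 (level (ℓ + w)) (orbit (level (ℓ + w)) (w - y))) 1 z := by
    refine ((hasDerivAt_id z).sub_const y).congr_of_eventuallyEq ?_
    filter_upwards [lt_mem_nhds hz] with w hw using travel_orbit_level hy hw
  have h3 := h1.unique h2
  refine hN.congr_deriv ?_
  have hq := speed_pos (level (ℓ + z)) (orbit (level (ℓ + z)) (z - y))
  have hT := travel_pos 3 (level (ℓ + z)) one_pos
  have he := Real.exp_pos (level (ℓ + z))
  unfold wallFactor
  generalize speed (level (ℓ + z)) (orbit (level (ℓ + z)) (z - y)) = q at *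
  norm_num at h3
  field_simp at h3 ⊢
  linarith

/-- The second derivative of the height of the orbit with respect to the position of the zero. -/
noncomputable def orbitSecondDeriv (θ u : ℝ) : ℝ :=
  ((-4 * u * (1 - u ^ 2) * (speed θ u * wallFactor θ u) - 2 / travel 3 θ 1) / (2 * speed θ u)) *
      wallFactor θ u +
    speed θ u * (-(3 / travel 3 θ 1 * travel 5 θ u + (speed θ u ^ 3)⁻¹ *
        (speed θ u * wallFactor θ u)) / travel 3 θ 1 +
      travel 3 θ u * (3 / travel 3 θ 1 * travel 5 θ 1) / travel 3 θ 1 ^ 2)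

lemma hasDerivAt_deriv_orbit_level (hy : -ℓ < y) (hz : y < z) :
    HasDerivAt (fun w => speed (level (ℓ + w)) (orbit (level (ℓ + w)) (w - y)) *
        wallFactor (level (ℓ + w)) (orbit (level (ℓ + w)) (w - y)))
      (orbitSecondDeriv (level (ℓ + z)) (orbit (level (ℓ + z)) (z - y))) z := by
  have hN := hasDerivAt_orbit_level hy hz
  have hl := hasDerivAt_level (hy.trans hz)
  have hT := travel_pos 3 (level (ℓ + z)) one_pos
  have he := Real.exp_pos (level (ℓ + z))
  have h := (hasDerivAt_speed_comp hl hN).mul (((hasDerivAt_travel_comp (k := 3) hl hN).div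
    (hasDerivAt_travel_comp (k := 3) hl (hasDerivAt_const z 1)) hT.ne').const_sub 1)
  refine h.congr_deriv ?_
  have hq := speed_pos (level (ℓ + z)) (orbit (level (ℓ + z)) (z - y))
  simp only [orbitSecondDeriv, wallFactor, Pi.div_apply]
  generalize speed (level (ℓ + z)) (orbit (level (ℓ + z)) (z - y)) = q at *
  norm_num
  field_simp
  ring

end WallOrbit

/-! ### Error bounds of order `ε = e^(θ/2)` for the derivatives of the orbit. -/

section Estimates

variable {θ u : ℝ}

/-- Together with `half_le_speed`, this makes the speed comparable to `D = 1 - u + ε`, whose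
negative powers have explicit primitives. -/
lemma speed_le_two_mul (h0 : 0 ≤ u) (h1 : u ≤ 1) :
    speed θ u ≤ 2 * (1 - u + Real.exp (θ / 2)) := by
  have he := Real.exp_pos (θ / 2)
  refine (speed_le_add (by nlinarith)).trans ?_
  nlinarith

lemma half_le_speed (h0 : 0 ≤ u) (h1 : u ≤ 1) :
    (1 - u + Real.exp (θ / 2)) / 2 ≤ speed θ u := by
  have h2 := exp_half_le_speed θ u
  have h3 := one_sub_sq_le_speed θ u
  nlinarith

lemma hasDerivAt_inv_pow_sub {a x : ℝ} (k : ℕ) (h : a - x ≠ 0) :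
    HasDerivAt (fun x => ((a - x) ^ k)⁻¹) (k * ((a - x) ^ (k + 1))⁻¹) x := by
  refine ((((hasDerivAt_id x).const_sub a).pow k).inv (pow_ne_zero k h)).congr_deriv ?_
  rcases k with _ | k
  · simp
  · simp
    field_simp
    ring

lemma travel_succ_le (k : ℕ) (hk : k ≠ 0) (h0 : 0 ≤ u) (h1 : u ≤ 1) :
    travel (k + 1) θ u ≤ 2 ^ (k + 1) * ((1 - u + Real.exp (θ / 2)) ^ k)⁻¹ := by
  have he := Real.exp_pos (θ / 2)
  set a := 1 + Real.exp (θ / 2) with ha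
  have hk' : (1 : ℝ) ≤ k := by exact_mod_cast Nat.one_le_iff_ne_zero.2 hk
  have h := sub_le_sub_of_hasDerivAt_le h0 (fun x _ => hasDerivAt_travel_right (k + 1) θ x)
    (fun x hx => (hasDerivAt_inv_pow_sub (a := a) (x := x) k
      (by linarith [hx.2])).const_mul (2 ^ (k + 1) : ℝ))
    (fun x hx => by
      have hx' := half_le_speed (θ := θ) hx.1 (hx.2.trans h1)
      have hD : 0 < 1 - x + Real.exp (θ / 2) := by linarith [hx.2]
      rw [show a - x = 1 - x + Real.exp (θ / 2) by rw [ha]; ring]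
      calc (speed θ x ^ (k + 1))⁻¹ ≤ (((1 - x + Real.exp (θ / 2)) / 2) ^ (k + 1))⁻¹ :=
            inv_anti₀ (by positivity) (by gcongr)
        _ = 2 ^ (k + 1) * (1 * ((1 - x + Real.exp (θ / 2)) ^ (k + 1))⁻¹) := by
            rw [div_pow, inv_div]; ring
        _ ≤ _ := by gcongr)
  have h3 : (0 : ℝ) ≤ 2 ^ (k + 1) * ((a - 0) ^ k)⁻¹ := by
    have : 0 < a := by linarith
    rw [sub_zero]; positivity
  rw [travel_zero, show a - u = 1 - u + Real.exp (θ / 2) by rw [ha]; ring] at h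
  linarith

/-- The speed is at most `2D`, and `D⁻² / 16` is a primitive of `(2D)⁻³`. Since `ε ≤ 1`, its value
at `0` is at most a quarter of that at `1`, whence `3/64 = (1/16)(3/4)`. -/
lemma le_travel_three_one (hθ : Real.exp (θ / 2) ≤ 1) :
    3 / 64 ≤ travel 3 θ 1 * Real.exp (θ / 2) ^ 2 := by
  have he := Real.exp_pos (θ / 2)
  set ε := Real.exp (θ / 2) with hε
  have h := sub_le_sub_of_hasDerivAt_le zero_le_one
    (fun x hx => (hasDerivAt_inv_pow_sub (a := 1 + ε) (x := x) 2
      (by linarith [hx.2])).const_mul (1 / 16))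
    (fun x _ => hasDerivAt_travel_right 3 θ x)
    (fun x hx => by
      have hx' := speed_le_two_mul (θ := θ) hx.1 hx.2
      have hD : 0 < 1 - x + ε := by linarith [hx.2]
      rw [show 1 + ε - x = 1 - x + ε by ring]
      calc (1 / 16 : ℝ) * ((2 : ℕ) * ((1 - x + ε) ^ (2 + 1))⁻¹)
          = ((2 * (1 - x + ε)) ^ 3)⁻¹ := by
            rw [mul_pow, mul_inv]; push_cast; ring
        _ ≤ (speed θ x ^ 3)⁻¹ := inv_anti₀ (pow_pos (speed_pos θ x) 3)
            (by have := speed_pos θ x; gcongr))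
  rw [travel_zero, sub_zero, sub_zero, add_sub_cancel_left] at h
  have h4 : ((1 + ε) ^ 2)⁻¹ ≤ (ε ^ 2)⁻¹ / 4 := by
    rw [div_eq_mul_inv, ← mul_inv]
    exact inv_anti₀ (by positivity) (by nlinarith)
  have h5 : 3 / 64 * (ε ^ 2)⁻¹ ≤ travel 3 θ 1 := by linarith
  calc (3 / 64 : ℝ) = 3 / 64 * (ε ^ 2)⁻¹ * ε ^ 2 := by field_simp
    _ ≤ _ := by gcongr

lemma inv_travel_three_one_le (hθ : Real.exp (θ / 2) ≤ 1) :
    (travel 3 θ 1)⁻¹ ≤ 22 * Real.exp (θ / 2) ^ 2 := by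
  have h := le_travel_three_one hθ
  have hp := travel_pos 3 θ one_pos
  rw [inv_le_iff_one_le_mul₀' hp]
  linarith

lemma wallFactor_le_one (h0 : 0 ≤ u) : wallFactor θ u ≤ 1 := by
  have := div_nonneg (travel_nonneg 3 θ h0) (travel_nonneg 3 θ zero_le_one)
  unfold wallFactor; linarith

lemma wallFactor_nonneg (h1 : u ≤ 1) : 0 ≤ wallFactor θ u := by
  have := (div_le_one (travel_pos 3 θ one_pos)).2 ((travel_strictMono 3 θ).monotone h1)
  unfold wallFactor; linarith

/-- The energy correction is a quotient of a numerator `O(D⁻²)` by a denominator of order at least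
`ε⁻²`; the constant is `8 · 22`. -/
lemma one_sub_wallFactor_le (hθ : Real.exp (θ / 2) ≤ 1) (h0 : 0 ≤ u) (h1 : u ≤ 1) :
    (1 - u + Real.exp (θ / 2)) ^ 2 * (1 - wallFactor θ u) ≤ 176 * Real.exp (θ / 2) ^ 2 := by
  have he := Real.exp_pos (θ / 2)
  have h := travel_succ_le (θ := θ) 2 two_ne_zero h0 h1
  have hD : 0 < 1 - u + Real.exp (θ / 2) := by linarith
  have hR := inv_travel_three_one_le hθ
  have hT := travel_pos 3 θ one_pos
  calc (1 - u + Real.exp (θ / 2)) ^ 2 * (1 - wallFactor θ u)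
      = (1 - u + Real.exp (θ / 2)) ^ 2 * (travel 3 θ u * (travel 3 θ 1)⁻¹) := by
        unfold wallFactor; ring
    _ ≤ (1 - u + Real.exp (θ / 2)) ^ 2 *
        (2 ^ (2 + 1) * ((1 - u + Real.exp (θ / 2)) ^ 2)⁻¹ * (22 * Real.exp (θ / 2) ^ 2)) := by
        gcongr
    _ = _ := by field_simp; ring

lemma one_sub_wallFactor_mul_le (hθ : Real.exp (θ / 2) ≤ 1) (h0 : 0 ≤ u) (h1 : u ≤ 1) :
    (1 - u + Real.exp (θ / 2)) * (1 - wallFactor θ u) ≤ 176 * Real.exp (θ / 2) := by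
  have he := Real.exp_pos (θ / 2)
  have h := one_sub_wallFactor_le hθ h0 h1
  have hw := wallFactor_le_one (θ := θ) h0
  have hD : Real.exp (θ / 2) ≤ 1 - u + Real.exp (θ / 2) := by linarith
  refine le_of_mul_le_mul_left ?_ he
  calc _ ≤ (1 - u + Real.exp (θ / 2)) * ((1 - u + Real.exp (θ / 2)) * (1 - wallFactor θ u)) := by
        gcongr
    _ ≤ _ := by linarith

variable {x : ℝ}

/-- Three errors of order `ε` add up: speed against `1 - u²`, wall factor against `1`, and `u`
against `x`. In the application `x` is the height of the instanton. -/
lemma abs_speed_mul_wallFactor_sub_le (hθ : Real.exp (θ / 2) ≤ 1) (h0 : 0 ≤ u) (h1 : u ≤ 1)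
    (hx0 : 0 ≤ x) (hx1 : x ≤ 1) (hx : |u - x| ≤ Real.exp (θ / 2)) :
    |speed θ u * wallFactor θ u - (1 - x ^ 2)| ≤ 400 * Real.exp (θ / 2) := by
  have h := one_sub_wallFactor_mul_le hθ h0 h1
  have hw := wallFactor_le_one (θ := θ) h0
  have hq := speed_le_two_mul (θ := θ) h0 h1
  have hq1 := one_sub_sq_le_speed θ u
  have hq2 := speed_le_add (θ := θ) (s := u) (by nlinarith)
  have hJ : speed θ u * (1 - wallFactor θ u) ≤ 352 * Real.exp (θ / 2) := by
    have := mul_le_mul_of_nonneg_right hq (sub_nonneg.2 hw)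
    linarith
  have hJ0 := mul_nonneg (speed_pos θ u).le (sub_nonneg.2 hw)
  obtain ⟨h2, h3⟩ := abs_le.1 hx
  have h4 : |x ^ 2 - u ^ 2| ≤ 2 * Real.exp (θ / 2) := by
    rw [show x ^ 2 - u ^ 2 = -((u - x) * (u + x)) by ring, abs_neg, abs_mul,
      abs_of_nonneg (add_nonneg h0 hx0), mul_comm]
    gcongr
    linarith
  obtain ⟨h5, h6⟩ := abs_le.1 h4
  rw [abs_le]
  constructor <;> linarith

/-- This isolates the main term, the first one; each of the others is `O(ε)`. -/
lemma orbitSecondDeriv_eq : orbitSecondDeriv θ u =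
    -2 * u * (1 - u ^ 2) * wallFactor θ u ^ 2
      - 2 * ((travel 3 θ 1)⁻¹ * (speed θ u)⁻¹ * wallFactor θ u)
      - 3 * (speed θ u * (travel 3 θ 1)⁻¹ ^ 2 * travel 5 θ u)
      + 3 * (speed θ u * travel 3 θ u * travel 5 θ 1 * (travel 3 θ 1)⁻¹ ^ 3) := by
  have hq := (speed_pos θ u).ne'
  have hT := (travel_pos 3 θ one_pos).ne'
  unfold orbitSecondDeriv
  field_simp
  ring

lemma abs_orbitSecondDeriv_add_le (hθ : Real.exp (θ / 2) ≤ 1) (h0 : 0 ≤ u) (h1 : u ≤ 1)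
    (hx0 : 0 ≤ x) (hx1 : x ≤ 1) (hx : |u - x| ≤ Real.exp (θ / 2)) :
    |orbitSecondDeriv θ u + 2 * x * (1 - x ^ 2)| ≤ 20000000 * Real.exp (θ / 2) := by
  have h := one_sub_wallFactor_mul_le hθ h0 h1
  have hw := wallFactor_le_one (θ := θ) h0
  have hw0 := wallFactor_nonneg (θ := θ) h1
  have hq := speed_le_two_mul (θ := θ) h0 h1
  have hq1 := half_le_speed (θ := θ) h0 h1
  have hq0 := speed_pos θ u
  have hR := inv_travel_three_one_le hθ
  have hR0 := inv_pos.2 (travel_pos 3 θ one_pos)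
  have hT3 := travel_succ_le (θ := θ) 2 two_ne_zero h0 h1
  have hT5 := travel_succ_le (θ := θ) 4 four_ne_zero h0 h1
  have hT51 := travel_succ_le (θ := θ) 4 four_ne_zero zero_le_one le_rfl
  have hT3' := travel_nonneg 3 θ h0
  have hT5' := travel_nonneg 5 θ h0
  have hT51' := travel_nonneg 5 θ zero_le_one
  have he := Real.exp_pos (θ / 2)
  rw [orbitSecondDeriv_eq]
  generalize Real.exp (θ / 2) = ε at *
  norm_num at hT3 hT5 hT51
  generalize speed θ u = q at *
  generalize wallFactor θ u = J at *
  generalize (travel 3 θ 1)⁻¹ = R at *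
  have hD0 : 0 < 1 - u + ε := by linarith
  have hεD : ε ≤ 1 - u + ε := by linarith
  have hu : (1 - u ^ 2) ≤ 2 * (1 - u + ε) := by nlinarith
  set D := 1 - u + ε with hD
  -- Since `R = O(ε²)`, the three remainders `hA`, `hB`, `hC` are each `ε` times a power of `ε / D ≤
  -- 1`.
  have hA : 0 ≤ R * q⁻¹ * J ∧ R * q⁻¹ * J ≤ 44 * ε := by
    refine ⟨by positivity, ?_⟩
    calc R * q⁻¹ * J ≤ (22 * ε ^ 2) * (D / 2)⁻¹ * 1 := by gcongr
      _ = 44 * ε * (ε / D) := by field_simp; ring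
      _ ≤ 44 * ε * 1 := by gcongr; exact (div_le_one hD0).2 hεD
      _ = _ := by ring
  have hB : 0 ≤ q * R ^ 2 * travel 5 θ u ∧ q * R ^ 2 * travel 5 θ u ≤ 30976 * ε := by
    refine ⟨by positivity, ?_⟩
    calc q * R ^ 2 * travel 5 θ u ≤ (2 * D) * (22 * ε ^ 2) ^ 2 * (32 * (D ^ 4)⁻¹) := by gcongr
      _ = 30976 * ε * (ε / D) ^ 3 := by field_simp; ring
      _ ≤ 30976 * ε * 1 ^ 3 := by gcongr; exact (div_le_one hD0).2 hεD
      _ = _ := by ring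
  have hC : 0 ≤ q * travel 3 θ u * travel 5 θ 1 * R ^ 3 ∧
      q * travel 3 θ u * travel 5 θ 1 * R ^ 3 ≤ 5451776 * ε := by
    refine ⟨by positivity, ?_⟩
    calc q * travel 3 θ u * travel 5 θ 1 * R ^ 3
        ≤ (2 * D) * (8 * (D ^ 2)⁻¹) * (32 * (ε ^ 4)⁻¹) * (22 * ε ^ 2) ^ 3 := by gcongr
      _ = 5451776 * ε * (ε / D) := by field_simp; ring
      _ ≤ 5451776 * ε * 1 := by gcongr; exact (div_le_one hD0).2 hεD
      _ = _ := by ring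
  have hE : 0 ≤ 2 * u * (1 - u ^ 2) * (1 - J ^ 2) ∧
      2 * u * (1 - u ^ 2) * (1 - J ^ 2) ≤ 2000 * ε := by
    have h2 : 0 ≤ 1 - u ^ 2 := by nlinarith
    have h3 : 0 ≤ 1 - J ^ 2 := by nlinarith
    refine ⟨by positivity, ?_⟩
    calc 2 * u * (1 - u ^ 2) * (1 - J ^ 2) ≤ 2 * 1 * (2 * D) * (2 * (1 - J)) := by
          gcongr; nlinarith
      _ = 8 * (D * (1 - J)) := by ring
      _ ≤ _ := by linarith
  have hF : |x * (1 - x ^ 2) - u * (1 - u ^ 2)| ≤ 2 * ε := by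
    rw [show x * (1 - x ^ 2) - u * (1 - u ^ 2) = (u - x) * (u ^ 2 + u * x + x ^ 2 - 1) by ring,
      abs_mul, mul_comm]
    gcongr
    rw [abs_le]
    constructor <;> nlinarith [mul_nonneg h0 hx0]
  obtain ⟨h5, h6⟩ := abs_le.1 hF
  rw [abs_le]
  constructor <;> linarith

end Estimates

/-! ### Exponential smallness of the energy level. -/

lemma exp_half_level_le_one {L : ℝ} (hL : 1 ≤ L) : Real.exp (level L / 2) ≤ 1 := by
  have h := travel_one_le (level L)
  rw [travel_level (by linarith)] at h
  have : 0 ≤ -(level L / 2) := Real.one_le_exp_iff.1 (hL.trans h)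
  exact Real.exp_le_one_iff.2 (by linarith)

/-- At distance `w` from the well, the squared speed `q²` is close to `r² = e^θ + 4w²`: `r² - q² ≤
4w³`. As `q ≥ w` and `r ≥ 2w`, the difference `1/q - 1/r = (r² - q²) / (qr(q + r))` is at most
`2/3`. The comparison function integrates to an `arsinh`. -/
lemma speed_one_sub_inv_le {θ w : ℝ} (h0 : 0 ≤ w) (h1 : w ≤ 1) :
    (speed θ (1 - w))⁻¹ ≤ 2 / 3 + (√(Real.exp θ + 4 * w ^ 2))⁻¹ := by
  have he := Real.exp_pos θ
  have hq := speed_pos θ (1 - w)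
  have hr : 0 < √(Real.exp θ + 4 * w ^ 2) := Real.sqrt_pos.2 (by positivity)
  have hq2 := speed_sq θ (1 - w)
  have hr2 : √(Real.exp θ + 4 * w ^ 2) ^ 2 = Real.exp θ + 4 * w ^ 2 := Real.sq_sqrt (by positivity)
  have hq3 : w ≤ speed θ (1 - w) :=
    (by nlinarith : w ≤ 1 - (1 - w) ^ 2).trans (one_sub_sq_le_speed _ _)
  have hr3 : 2 * w ≤ √(Real.exp θ + 4 * w ^ 2) := Real.le_sqrt_of_sq_le (by nlinarith)
  generalize speed θ (1 - w) = q at *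
  generalize √(Real.exp θ + 4 * w ^ 2) = r at *
  have h2 : 3 * (r ^ 2 - q ^ 2) ≤ 12 * w ^ 3 := by
    rw [hq2, hr2]; nlinarith [sq_nonneg (w ^ 2)]
  have h3 : 12 * w ^ 3 ≤ 2 * q * r * (r + q) :=
    calc 12 * w ^ 3 = 2 * w * (2 * w) * (2 * w + w) := by ring
      _ ≤ _ := by gcongr
  have h4 : 3 * (r - q) ≤ 2 * q * r := by
    refine le_of_mul_le_mul_right ?_ (add_pos hr hq)
    linarith
  field_simp
  linarith

lemma travel_one_one_le (θ : ℝ) :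
    travel 1 θ 1 ≤ 2 / 3 + 1 / 2 * Real.arsinh (2 / Real.exp (θ / 2)) := by
  have he := Real.exp_pos (θ / 2)
  set ε := Real.exp (θ / 2) with hε
  have h := sub_le_sub_of_hasDerivAt_le zero_le_one (fun x _ => hasDerivAt_travel_right 1 θ x)
    (fun x _ => ((hasDerivAt_id x).const_mul (2 / 3)).sub
      (((((hasDerivAt_id x).const_sub 1).const_mul 2).div_const ε).arsinh.const_mul (1 / 2)))
    (fun x hx => by
      have h := speed_one_sub_inv_le (θ := θ) (w := 1 - x) (by linarith [hx.2]) (by linarith [hx.1])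
      rw [sub_sub_cancel, ← exp_half_sq, ← hε] at h
      rw [pow_one]
      refine h.trans_eq ?_
      have : √(ε ^ 2 + 4 * (1 - x) ^ 2) = ε * √(1 + (2 * (1 - x) / ε) ^ 2) := by
        rw [← Real.sqrt_sq he.le, ← Real.sqrt_mul (by positivity), Real.sqrt_sq he.le]
        congr 1
        field_simp
        ring
      simp only [id, this, smul_eq_mul, mul_inv]
      field_simp
      ring)
  simp at h
  linarith

/-- The travel time is at most `2/3 + log (5/ε) / 2`; the exact factor `1/2` before the logarithm
gives the rate `2`. -/
lemma exp_half_level_le {L : ℝ} (hL : 1 ≤ L) :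
    Real.exp (level L / 2) ≤ 5 * Real.exp (4 / 3) * Real.exp (-2 * L) := by
  have he := Real.exp_pos (level L / 2)
  have h1 := exp_half_level_le_one hL
  have h := travel_one_one_le (level L)
  rw [travel_level (by linarith)] at h
  set ε := Real.exp (level L / 2) with hε
  -- The argument of the logarithm is at most `2/ε + (1 + 2/ε)`, and `1 ≤ 1/ε`.
  have h2 : Real.arsinh (2 / ε) ≤ Real.log (5 / ε) := by
    unfold Real.arsinh
    have h0 : √(1 + (2 / ε) ^ 2) ≤ 1 + 2 / ε :=
      (Real.sqrt_le_left (by positivity)).2 (by nlinarith [div_pos two_pos he])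
    have h4 : 1 ≤ 1 / ε := (one_le_div he).2 h1
    refine Real.log_le_log (by positivity) ?_
    rw [div_eq_mul_one_div 5 ε]
    rw [div_eq_mul_one_div 2 ε] at h0 ⊢
    linarith
  have h3 : 2 * L - 4 / 3 ≤ Real.log (5 / ε) := by linarith
  rw [Real.le_log_iff_exp_le (by positivity), le_div_iff₀ he] at h3
  calc ε = Real.exp (2 * L - 4 / 3) * ε * (Real.exp (4 / 3) * Real.exp (-2 * L)) := by
        rw [mul_right_comm, ← Real.exp_add, ← Real.exp_add]
        ring_nf; simp
    _ ≤ 5 * (Real.exp (4 / 3) * Real.exp (-2 * L)) := by gcongr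
    _ = _ := by ring

lemma abs_orbit_sub_tanh_le {θ t : ℝ} (ht : t ∈ Icc 0 (travel 1 θ 1)) :
    |orbit θ t - Real.tanh t| ≤ Real.exp (θ / 2) := by
  obtain ⟨u, hu, rfl⟩ := exists_eq_travel ht
  rw [orbit_travel]
  have h1 := tanh_travel_le θ hu.1 hu.2
  have h2 := le_mul_tanh_travel θ hu.1 hu.2
  have h3 := (Real.tanh_lt_one (travel 1 θ u)).le
  have he := Real.exp_pos (θ / 2)
  rw [abs_le]
  constructor <;> nlinarith

/-! ### The candidate profile: gluing, regularity and membership in the space. -/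

/-- The function that is equal to `-1` up to the wall at `-ℓ`, follows the orbit that vanishes at
`z`, and continues as the instanton. -/
noncomputable def wallProfile (ℓ z y : ℝ) : ℝ :=
  if y ≤ -ℓ then -1 else if y ≤ z then -orbit (level (ℓ + z)) (z - y) else Real.tanh (y - z)

section WallProfile

variable {ℓ z y : ℝ}

lemma wallProfile_of_le (hy : y ≤ -ℓ) : wallProfile ℓ z y = -1 := if_pos hy

lemma wallProfile_of_mem (hz : -ℓ < z) (hy : y ∈ Icc (-ℓ) z) :
    wallProfile ℓ z y = -orbit (level (ℓ + z)) (z - y) := by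
  rcases hy.1.eq_or_lt with rfl | h
  · rw [wallProfile_of_le le_rfl, sub_neg_eq_add, add_comm, orbit_level (by linarith)]
  · rw [wallProfile, if_neg h.not_ge, if_pos hy.2]

lemma wallProfile_of_ge (hz : -ℓ < z) (hy : z ≤ y) : wallProfile ℓ z y = Real.tanh (y - z) := by
  rcases hy.eq_or_lt with rfl | h
  · rw [wallProfile_of_mem hz ⟨hz.le, le_rfl⟩]; simp
  · rw [wallProfile, if_neg (by linarith), if_neg h.not_ge]

lemma sub_mem_time (hz : -ℓ < z) (hy : y ∈ Icc (-ℓ) z) :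
    z - y ∈ Icc 0 (travel 1 (level (ℓ + z)) 1) := by
  rw [travel_level (by linarith)]
  constructor <;> linarith [hy.1, hy.2]

lemma hasDerivAt_neg_orbit (hz : -ℓ < z) (hy : y ∈ Icc (-ℓ) z) :
    HasDerivAt (fun y => -orbit (level (ℓ + z)) (z - y))
      (speed (level (ℓ + z)) (wallProfile ℓ z y)) y := by
  rw [wallProfile_of_mem hz hy, speed_neg]
  have := (hasDerivAt_orbit (sub_mem_time hz hy)).comp y ((hasDerivAt_id y).const_sub z)
  refine this.neg.congr_deriv ?_
  simp

lemma hasDerivAt_wallProfile_of_mem (hy : y ∈ Ioo (-ℓ) z) :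
    HasDerivAt (wallProfile ℓ z) (speed (level (ℓ + z)) (wallProfile ℓ z y)) y := by
  have hz := hy.1.trans hy.2
  refine (hasDerivAt_neg_orbit hz (Ioo_subset_Icc_self hy)).congr_of_eventuallyEq ?_
  filter_upwards [Ioo_mem_nhds hy.1 hy.2] with x hx
  exact wallProfile_of_mem hz (Ioo_subset_Icc_self hx)

lemma hasDerivAt_wallProfile_of_gt (hz : -ℓ < z) (hy : z < y) :
    HasDerivAt (wallProfile ℓ z) (1 - Real.tanh (y - z) ^ 2) y := by
  have h := (hasDerivAt_tanh (y - z)).comp_sub_const y z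
  refine h.congr_of_eventuallyEq ?_
  filter_upwards [lt_mem_nhds hy] with x hx using wallProfile_of_ge hz hx.le

lemma wallProfile_mem (hz : -ℓ < z) (hy : y ∈ Icc (-ℓ) z) : wallProfile ℓ z y ∈ Icc (-1) 0 := by
  have := orbit_mem (sub_mem_time hz hy)
  rw [wallProfile_of_mem hz hy]
  constructor <;> linarith [this.1, this.2]

lemma wallProfile_apply_self (hz : -ℓ < z) : wallProfile ℓ z z = 0 := by
  simp [wallProfile_of_ge hz le_rfl]

lemma abs_wallProfile_le_one (hz : -ℓ < z) : |wallProfile ℓ z y| ≤ 1 := by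
  rcases le_total y (-ℓ) with h | h
  · simp [wallProfile_of_le h]
  rcases le_total y z with h' | h'
  · have := wallProfile_mem hz ⟨h, h'⟩
    exact abs_le.2 ⟨this.1, by linarith [this.2]⟩
  · rw [wallProfile_of_ge hz h']
    exact (Real.abs_tanh_lt_one _).le

lemma continuous_wallProfile (hz : -ℓ < z) : Continuous (wallProfile ℓ z) := by
  have h1 : ContinuousOn (wallProfile ℓ z) (Iic (-ℓ)) :=
    continuousOn_const.congr fun x hx => wallProfile_of_le hx
  have h2 : ContinuousOn (wallProfile ℓ z) (Icc (-ℓ) z) := by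
    refine ContinuousOn.congr (fun x hx => ?_) fun x hx => wallProfile_of_mem hz hx
    exact (hasDerivAt_neg_orbit hz hx).continuousAt.continuousWithinAt
  have h3 : ContinuousOn (wallProfile ℓ z) (Ici z) :=
    (continuous_tanh.comp (continuous_id.sub continuous_const)).continuousOn.congr
      fun x hx => wallProfile_of_ge hz hx
  have h4 := (h1.union_of_isClosed h2 isClosed_Iic isClosed_Icc).union_of_isClosed h3
    (isClosed_Iic.union isClosed_Icc) isClosed_Ici
  rwa [Iic_union_Icc_eq_Iic hz.le, Iic_union_Ici, continuousOn_univ] at h4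

lemma speed_level_le {u : ℝ} (hu : |u| ≤ 1) (L : ℝ) :
    speed (level L) u ≤ 1 + Real.exp (level L / 2) := by
  have h := speed_le_add (θ := level L) ((sq_le_one_iff_abs_le_one u).2 hu)
  nlinarith

/-- On each of the three pieces the derivative lies between `0` and `1 + ε`; both inequalities chain
across the junctions. -/
lemma wallProfile_lipschitz_of_le (hz : -ℓ < z) {a b : ℝ} (hab : a ≤ b) :
    wallProfile ℓ z a ≤ wallProfile ℓ z b ∧
    wallProfile ℓ z b - wallProfile ℓ z a ≤ (1 + Real.exp (level (ℓ + z) / 2)) * (b - a) := by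
  set K := 1 + Real.exp (level (ℓ + z) / 2) with hK
  have hK1 : 1 ≤ K := by have := Real.exp_pos (level (ℓ + z) / 2); linarith
  set P : ℝ → ℝ → Prop := fun a b => wallProfile ℓ z a ≤ wallProfile ℓ z b ∧
    wallProfile ℓ z b - wallProfile ℓ z a ≤ K * (b - a) with hP
  have htrans {a b c : ℝ} (h1 : P a b) (h2 : P b c) : P a c :=
    ⟨h1.1.trans h2.1, by linarith [h1.2, h2.2]⟩
  have hder {s : Set ℝ} (hs : Convex ℝ s) {f : ℝ → ℝ} (hf : ∀ x ∈ s, 0 ≤ f x ∧ f x ≤ K)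
      (hd : ∀ x ∈ interior s, HasDerivAt (wallProfile ℓ z) (f x) x) {a b : ℝ} (ha : a ∈ s)
      (hb : b ∈ s) (hab : a ≤ b) : P a b := by
    have hc := (continuous_wallProfile hz).continuousOn (s := s)
    constructor
    · exact monotoneOn_of_hasDerivWithinAt_nonneg hs hc (fun x hx => (hd x hx).hasDerivWithinAt)
        (fun x hx => (hf x (interior_subset hx)).1) ha hb hab
    · refine hs.image_sub_le_mul_sub_of_deriv_le hc
        (fun x hx => (hd x hx).differentiableAt.differentiableWithinAt) ?_ a ha b hb hab
      exact fun x hx => (hd x hx).deriv.trans_le (hf x (interior_subset hx)).2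
  have hleft {a b : ℝ} (ha : a ∈ Iic (-ℓ)) (hb : b ∈ Iic (-ℓ)) (hab : a ≤ b) : P a b := by
    simp only [hP, wallProfile_of_le ha, wallProfile_of_le hb]
    exact ⟨le_rfl, by rw [sub_self]; exact mul_nonneg (by linarith) (by linarith)⟩
  have hmid {a b : ℝ} (ha : a ∈ Icc (-ℓ) z) (hb : b ∈ Icc (-ℓ) z) (hab : a ≤ b) : P a b := by
    refine hder (convex_Icc _ _) (f := fun y => speed (level (ℓ + z)) (wallProfile ℓ z y))
      (fun x _ => ⟨(speed_pos _ _).le, speed_level_le (abs_wallProfile_le_one hz) _⟩)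
      (fun x hx => hasDerivAt_wallProfile_of_mem (by rwa [interior_Icc] at hx)) ha hb hab
  have hright {a b : ℝ} (ha : a ∈ Ici z) (hb : b ∈ Ici z) (hab : a ≤ b) : P a b := by
    refine hder (convex_Ici _) (f := fun y => 1 - Real.tanh (y - z) ^ 2)
      (fun x _ => ⟨by linarith [Real.tanh_sq_lt_one (x - z)], by nlinarith [Real.tanh (x - z)]⟩)
      (fun x hx => hasDerivAt_wallProfile_of_gt hz (by simpa using hx)) ha hb hab
  have hrest {a b : ℝ} (ha : -ℓ ≤ a) (hab : a ≤ b) : P a b := by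
    rcases le_total b z with hb | hb
    · exact hmid ⟨ha, hab.trans hb⟩ ⟨ha.trans hab, hb⟩ hab
    rcases le_total a z with ha' | ha'
    · exact htrans (hmid ⟨ha, ha'⟩ ⟨hz.le, le_rfl⟩ ha') (hright self_mem_Ici hb hb)
    · exact hright ha' hb hab
  rcases le_total (-ℓ) a with ha | ha
  · exact hrest ha hab
  rcases le_total b (-ℓ) with hb | hb
  · exact hleft ha hb hab
  · exact htrans (hleft ha self_mem_Iic ha) (hrest le_rfl hb)

lemma monotone_wallProfile (hz : -ℓ < z) : Monotone (wallProfile ℓ z) :=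
  fun _ _ h => (wallProfile_lipschitz_of_le hz h).1

lemma isLocallyAC_wallProfile (hz : -ℓ < z) : IsLocallyAC (wallProfile ℓ z) := by
  intro a b
  have h : LipschitzWith (1 + Real.exp (level (ℓ + z) / 2)).toNNReal (wallProfile ℓ z) := by
    refine LipschitzWith.of_le_add_mul _ fun x y => ?_
    have h0 : 0 ≤ 1 + Real.exp (level (ℓ + z) / 2) := by positivity
    rw [Real.coe_toNNReal _ h0]
    rcases le_total x y with h | h
    · have := monotone_wallProfile hz h
      have := mul_nonneg h0 (dist_nonneg (x := x) (y := y))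
      linarith
    · have := (wallProfile_lipschitz_of_le hz h).2
      rw [Real.dist_eq, abs_of_nonneg (by linarith)]
      linarith
  exact h.lipschitzOnWith.absolutelyContinuousOnInterval

lemma one_sub_tanh_le (x : ℝ) : 1 - Real.tanh x ≤ 2 * Real.exp (-2 * x) := by
  rw [Real.tanh_eq, show (-2 * x) = -x + -x by ring, Real.exp_add, Real.exp_neg]
  have := Real.exp_pos x
  generalize Real.exp x = e at *
  field_simp
  nlinarith

lemma wallProfile_mem_profileSpace (hz : -ℓ < z) : wallProfile ℓ z ∈ profileSpace ℓ := by
  refine ⟨?_, fun y hy => wallProfile_of_le hy.le⟩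
  have hm : AEStronglyMeasurable (fun y => wallProfile ℓ z y - Real.sign y) volume := by
    refine ((continuous_wallProfile hz).measurable.sub ?_).aestronglyMeasurable
    unfold Real.sign
    exact Measurable.ite measurableSet_Iio measurable_const
      (Measurable.ite measurableSet_Ioi measurable_const measurable_const)
  rw [memLp_two_iff_integrable_sq hm]
  set R := max |ℓ| |z| with hR
  have hRℓ := le_max_left |ℓ| |z|
  have hRz := le_max_right |ℓ| |z|
  have h1 : IntegrableOn (fun y => (wallProfile ℓ z y - Real.sign y) ^ 2) (Iio (-R)) := by
    refine integrableOn_zero.congr_fun (fun y hy => ?_) measurableSet_Iio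
    have hy : y < -R := hy
    have h0 : y < 0 := by linarith [abs_nonneg ℓ]
    simp [wallProfile_of_le (show y ≤ -ℓ by linarith [le_abs_self ℓ]), Real.sign_of_neg h0]
  have h2 : IntegrableOn (fun y => (wallProfile ℓ z y - Real.sign y) ^ 2) (Icc (-R) R) := by
    refine Measure.integrableOn_of_bounded (M := 4) (by simp) (hm.pow 2)
      (Eventually.of_forall fun y => ?_)
    have h3 : |Real.sign y| ≤ 1 := by
      rcases Real.sign_apply_eq y with h | h | h <;> simp [h]
    have h4 := abs_le.1 (abs_wallProfile_le_one hz (y := y))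
    have h5 := abs_le.1 h3
    rw [Real.norm_of_nonneg (sq_nonneg _)]
    nlinarith
  have h3 : IntegrableOn (fun y => (wallProfile ℓ z y - Real.sign y) ^ 2) (Ioi R) := by
    have h4 : IntegrableOn (fun y => 4 * Real.exp (4 * z) * Real.exp (-4 * y)) (Ioi R) :=
      (integrableOn_exp_mul_Ioi (by norm_num) R).const_mul _
    refine h4.mono' (hm.pow 2).restrict ?_
    refine (ae_restrict_iff' measurableSet_Ioi).2 (Eventually.of_forall fun y hy => ?_)
    have hy : R < y := hy
    have h0 : 0 < y := by linarith [abs_nonneg ℓ]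
    have h5 := one_sub_tanh_le (y - z)
    have h6 := Real.tanh_lt_one (y - z)
    rw [Real.norm_of_nonneg (sq_nonneg _), Real.sign_of_pos h0,
      wallProfile_of_ge hz (by linarith [le_abs_self z])]
    calc (Real.tanh (y - z) - 1) ^ 2 = (1 - Real.tanh (y - z)) ^ 2 := by ring
      _ ≤ (2 * Real.exp (-2 * (y - z))) ^ 2 := by gcongr
      _ = _ := by
        rw [mul_pow, ← Real.exp_nat_mul, mul_assoc, ← Real.exp_add]
        norm_num
        ring
  have h4 := (h1.union h2).union h3
  have hu : Iio (-R) ∪ Icc (-R) R ∪ Ioi R = univ := by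
    have : 0 ≤ R := (abs_nonneg ℓ).trans hRℓ
    rw [Iio_union_Icc_eq_Iic (by linarith), Iic_union_Ioi]
  rwa [hu, integrableOn_univ] at h4

end WallProfile

/-! ### Chain rule and completion of the square for absolutely continuous functions. -/

section Calibration

variable {W w n : ℝ → ℝ} {a b : ℝ}

lemma contDiff_one_of_hasDerivAt (hW : ∀ x, HasDerivAt W (w x) x) (hw : Continuous w) :
    ContDiff ℝ 1 W :=
  contDiff_one_iff_deriv.2 ⟨fun x => (hW x).differentiableAt,
    (funext fun x => (hW x).deriv : deriv W = w) ▸ hw⟩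

lemma LipschitzOnWith.comp_absolutelyContinuousOnInterval {K : NNReal} {s : Set ℝ}
    (hW : LipschitzOnWith K W s) (hn : AbsolutelyContinuousOnInterval n a b)
    (hs : MapsTo n (uIcc a b) s) : AbsolutelyContinuousOnInterval (W ∘ n) a b := by
  rw [absolutelyContinuousOnInterval_iff] at hn ⊢
  intro ε hε
  obtain ⟨δ, hδ, h⟩ := hn (ε / (K + 1)) (by positivity)
  refine ⟨δ, hδ, fun E hE hEδ => ?_⟩
  calc ∑ i ∈ Finset.range E.1, dist ((W ∘ n) (E.2 i).1) ((W ∘ n) (E.2 i).2)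
      ≤ ∑ i ∈ Finset.range E.1, K * dist (n (E.2 i).1) (n (E.2 i).2) :=
        Finset.sum_le_sum fun i hi =>
          hW.dist_le_mul _ (hs (hE.1 i hi).1) _ (hs (hE.1 i hi).2)
    _ = K * ∑ i ∈ Finset.range E.1, dist (n (E.2 i).1) (n (E.2 i).2) := by rw [Finset.mul_sum]
    _ ≤ K * (ε / (K + 1)) := by gcongr; exact (h E hE hEδ).le
    _ < (K + 1) * (ε / (K + 1)) := by gcongr; linarith
    _ = ε := by field_simp

/-- On a compact interval `n` is bounded, and `W` is Lipschitz on bounded intervals. -/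
lemma AbsolutelyContinuousOnInterval.contDiff_comp (hn : AbsolutelyContinuousOnInterval n a b)
    (hW : ContDiff ℝ 1 W) : AbsolutelyContinuousOnInterval (W ∘ n) a b := by
  obtain ⟨C, hC⟩ := isCompact_uIcc.exists_bound_of_continuousOn hn.continuousOn
  obtain ⟨K, hK⟩ := hW.contDiffOn.exists_lipschitzOnWith (by decide) (convex_Icc (-C) C)
    isCompact_Icc
  exact hK.comp_absolutelyContinuousOnInterval hn fun x hx => abs_le.1 (hC x hx)

/-- The chain rule in integrated form. -/
lemma AbsolutelyContinuousOnInterval.integral_comp_mul_deriv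
    (hn : AbsolutelyContinuousOnInterval n a b) (hW : ∀ x, HasDerivAt W (w x) x)
    (hw : Continuous w) : ∫ y in a..b, w (n y) * deriv n y = W (n b) - W (n a) := by
  rw [← Function.comp_apply (f := W), ← Function.comp_apply (f := W) (x := a),
    ← (hn.contDiff_comp (contDiff_one_of_hasDerivAt hW hw)).integral_deriv_eq_sub]
  refine intervalIntegral.integral_congr_ae ?_
  filter_upwards [hn.ae_differentiableAt] with y hy hy'
  exact ((hW (n y)).comp y (hy (uIoc_subset_uIcc hy')).hasDerivAt).deriv.symm

lemma IsLocallyAC.continuous (hn : IsLocallyAC n) : Continuous n := by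
  refine continuous_iff_continuousAt.2 fun x => ?_
  have := (hn (x - 1) (x + 1)).continuousOn
  exact this.continuousAt (by
    rw [uIcc_of_le (by linarith)]; exact Icc_mem_nhds (by linarith) (by linarith))

/-- Completion of the square. -/
lemma integral_sq_add_sq (hn : IsLocallyAC n) (hW : ∀ x, HasDerivAt W (w x) x)
    (hw : Continuous w) (hab : a ≤ b) (hi : IntegrableOn (fun y => deriv n y ^ 2) (Ioc a b)) :
    ∫ y in a..b, (deriv n y ^ 2 + w (n y) ^ 2) =
      2 * (W (n b) - W (n a)) + ∫ y in a..b, (deriv n y - w (n y)) ^ 2 := by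
  have hi' := (intervalIntegrable_iff_integrableOn_Ioc_of_le hab).2 hi
  have h1 : IntervalIntegrable (fun y => w (n y) * deriv n y) volume a b :=
    (hn a b).intervalIntegrable_deriv.continuousOn_mul (hw.comp hn.continuous).continuousOn
  have h2 : IntervalIntegrable (fun y => w (n y) ^ 2) volume a b :=
    ((hw.comp hn.continuous).pow 2).intervalIntegrable a b
  have h3 : IntervalIntegrable (fun y => (deriv n y - w (n y)) ^ 2) volume a b := by
    have := (hi'.add h2).sub (h1.const_mul 2)
    refine this.congr fun y _ => ?_
    ring
  rw [← (hn a b).integral_comp_mul_deriv hW hw, ← intervalIntegral.integral_const_mul,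
    ← intervalIntegral.integral_add (h1.const_mul 2) h3]
  congr 1; ext y; ring

end Calibration

/-! ### Minimality and uniqueness of the profile. -/

section Energy

variable {ℓ z : ℝ} {n : ℝ → ℝ}

/-- The energy density of a profile. -/
noncomputable def energyDensity (n : ℝ → ℝ) (y : ℝ) : ℝ := deriv n y ^ 2 + doubleWell (n y)

lemma energyDensity_nonneg (n : ℝ → ℝ) (y : ℝ) : 0 ≤ energyDensity n y :=
  add_nonneg (sq_nonneg _) (doubleWell_nonneg _)

lemma measurable_energyDensity (hn : IsLocallyAC n) : Measurable (energyDensity n) := by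
  have := hn.continuous.measurable
  have := measurable_deriv n
  unfold energyDensity doubleWell
  fun_prop

lemma integrableOn_deriv_sq {s : Set ℝ}
    (h : IntegrableOn (energyDensity n) s) : IntegrableOn (fun y => deriv n y ^ 2) s := by
  refine h.mono' ((measurable_deriv n).pow_const 2).aestronglyMeasurable
    (Eventually.of_forall fun y => ?_)
  rw [Real.norm_of_nonneg (sq_nonneg _)]
  exact le_add_of_nonneg_right (doubleWell_nonneg _)

/-- The energy of the constrained minimizer on the interval between the wall and its zero. -/
noncomputable def wallEnergy (ℓ z : ℝ) : ℝ :=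
  2 * (∫ s in (-1 : ℝ)..0, speed (level (ℓ + z)) s) - Real.exp (level (ℓ + z)) * (ℓ + z)

/-- Adding the constant `e^θ` to the potential turns it into the square of the speed, at the cost of
`e^θ (ℓ + z)`. The cross term of the completed square depends only on the values at the ends. -/
lemma integral_energyDensity_left (hn : IsLocallyAC n) (hz : -ℓ < z) (hnz : n z = 0)
    (hnℓ : n (-ℓ) = -1) (h : IntegrableOn (energyDensity n) (Ioc (-ℓ) z)) :
    ∫ y in Ioc (-ℓ) z, energyDensity n y = wallEnergy ℓ z +
      ∫ y in Ioc (-ℓ) z, (deriv n y - speed (level (ℓ + z)) (n y)) ^ 2 := by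
  have hc : Continuous (speed (level (ℓ + z))) :=
    continuous_speed_comp continuous_const continuous_id
  have h1 := integral_sq_add_sq hn (W := fun u => ∫ s in (0 : ℝ)..u, speed (level (ℓ + z)) s)
    (fun x => intervalIntegral.integral_hasDerivAt_right (hc.intervalIntegrable _ _)
      (hc.stronglyMeasurableAtFilter _ _) hc.continuousAt) hc hz.le (integrableOn_deriv_sq h)
  have h2 : ∫ y in (-ℓ)..z, (deriv n y ^ 2 + speed (level (ℓ + z)) (n y) ^ 2) =
      (∫ y in (-ℓ)..z, energyDensity n y) + Real.exp (level (ℓ + z)) * (ℓ + z) := by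
    have h3 : ∫ _ in (-ℓ)..z, Real.exp (level (ℓ + z)) = Real.exp (level (ℓ + z)) * (ℓ + z) := by
      rw [intervalIntegral.integral_const, smul_eq_mul]; ring
    rw [← h3, ← intervalIntegral.integral_add
      ((intervalIntegrable_iff_integrableOn_Ioc_of_le hz.le).2 h) (by simp)]
    congr 1; ext y
    rw [speed_sq, energyDensity, doubleWell]; ring
  rw [h2, hnz, hnℓ] at h1
  rw [← intervalIntegral.integral_of_le hz.le, ← intervalIntegral.integral_of_le hz.le, wallEnergy,
    intervalIntegral.integral_symm 0]
  rw [intervalIntegral.integral_same] at h1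
  linarith

/-- By Chebyshev, the set where `n` is `ε`-far from the sign has finite measure and cannot contain a
half-line. -/
lemma frequently_abs_sub_one_lt (hn : n ∈ profileSpace ℓ) {ε : ℝ} (hε : 0 < ε) :
    ∃ᶠ y in atTop, |n y - 1| < ε := by
  intro h
  obtain ⟨R, hR⟩ := eventually_atTop.1 h
  have h1 := (hn.1.integrable_sq).measure_ge_lt_top (pow_pos hε 2)
  have h2 : Ioi (max R 0) ⊆ {y | ε ^ 2 ≤ (n y - Real.sign y) ^ 2} := by
    intro y hy
    have h3 := not_lt.1 (hR y ((le_max_left _ _).trans hy.le))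
    rw [mem_ofPred_eq, Real.sign_of_pos ((le_max_right _ _).trans_lt hy), sq_le_sq, abs_of_pos hε]
    exact h3
  exact ((measure_mono h2).trans_lt h1).ne (by simp)

lemma integral_energyDensity_right (hn : IsLocallyAC n) (hn' : n ∈ profileSpace ℓ) (hnz : n z = 0)
    (h : IntegrableOn (energyDensity n) (Ioi z)) :
    IntegrableOn (fun y => (deriv n y - (1 - n y ^ 2)) ^ 2) (Ioi z) ∧
    ∫ y in Ioi z, energyDensity n y =
      4 / 3 + ∫ y in Ioi z, (deriv n y - (1 - n y ^ 2)) ^ 2 := by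
  have hnm := hn.continuous.measurable
  have hdm := measurable_deriv n
  have h1 : IntegrableOn (fun y => (deriv n y - (1 - n y ^ 2)) ^ 2) (Ioi z) := by
    refine (h.const_mul 2).mono' (by fun_prop) (Eventually.of_forall fun y => ?_)
    rw [Real.norm_of_nonneg (sq_nonneg _), energyDensity, doubleWell]
    nlinarith [sq_nonneg (deriv n y + (1 - n y ^ 2))]
  refine ⟨h1, ?_⟩
  have h2 : IntegrableOn (fun y => energyDensity n y - (deriv n y - (1 - n y ^ 2)) ^ 2) (Ioi z) :=
    h.sub h1
  have h3 := intervalIntegral_tendsto_integral_Ioi z h2 tendsto_id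
  have h4 (b : ℝ) : ∫ y in z..b, (energyDensity n y - (deriv n y - (1 - n y ^ 2)) ^ 2) =
      2 * n b - 2 / 3 * n b ^ 3 := by
    have := (hn z b).integral_comp_mul_deriv (W := fun u => 2 * u - 2 / 3 * u ^ 3)
      (w := fun u => 2 * (1 - u ^ 2)) (fun u => by
        refine (((hasDerivAt_id u).const_mul 2).sub
          (((hasDerivAt_id u).pow 3).const_mul (2 / 3))).congr_deriv ?_
        simp; ring) (by fun_prop)
    rw [hnz] at this
    simp only [mul_zero, ne_eq, OfNat.ofNat_ne_zero, not_false_eq_true, zero_pow, sub_self,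
      sub_zero] at this
    rw [← this]
    congr 1; ext y
    rw [energyDensity, doubleWell]; ring
  simp only [h4, id] at h3
  set I := ∫ y in Ioi z, (energyDensity n y - (deriv n y - (1 - n y ^ 2)) ^ 2) with hI
  -- The truncated integrals converge, so it is enough that `n` comes close to `1` at arbitrarily
  -- large points; there `2u - 2u³/3` is close to `4/3`.
  have h5 : I = 4 / 3 := by
    have hc : Tendsto (fun u : ℝ => 2 * u - 2 / 3 * u ^ 3) (𝓝 1) (𝓝 (4 / 3)) := by
      have : Continuous fun u : ℝ => 2 * u - 2 / 3 * u ^ 3 := by fun_prop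
      convert this.tendsto 1 using 2; norm_num
    refine eq_of_forall_dist_le fun δ hδ => ?_
    obtain ⟨ε, hε, hεδ⟩ := Metric.tendsto_nhds_nhds.1 hc (δ / 2) (half_pos hδ)
    obtain ⟨b, hb1, hb2⟩ := ((frequently_abs_sub_one_lt hn' hε).and_eventually
      (Metric.tendsto_nhds.1 h3 (δ / 2) (half_pos hδ))).exists
    have h6 := hεδ (x := n b) hb1
    rw [dist_comm] at hb2
    linarith [dist_triangle I (2 * n b - 2 / 3 * n b ^ 3) (4 / 3)]
  rw [hI, integral_sub h h1] at h5
  linarith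

lemma apply_neg_of_mem_profileSpace (hn : IsLocallyAC n) (hn' : n ∈ profileSpace ℓ) :
    n (-ℓ) = -1 := by
  have h1 : Tendsto n (𝓝[<] (-ℓ)) (𝓝 (n (-ℓ))) := hn.continuous.continuousAt.mono_left inf_le_left
  refine tendsto_nhds_unique h1 (tendsto_const_nhds.congr' ?_)
  filter_upwards [self_mem_nhdsWithin] with y hy using (hn'.2 y hy).symm

lemma integral_energyDensity (hn : IsLocallyAC n) (hn' : n ∈ profileSpace ℓ) (hz : -ℓ < z)
    (hnz : n z = 0) (h : IntegrableOn (energyDensity n) (Ioi (-ℓ))) :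
    ∫ y in Ioi (-ℓ), energyDensity n y = wallEnergy ℓ z + 4 / 3 +
      (∫ y in Ioc (-ℓ) z, (deriv n y - speed (level (ℓ + z)) (n y)) ^ 2) +
      ∫ y in Ioi z, (deriv n y - (1 - n y ^ 2)) ^ 2 := by
  have hl := h.mono_set (Ioc_subset_Ioi_self : Ioc (-ℓ) z ⊆ _)
  have hr := h.mono_set (Ioi_subset_Ioi hz.le)
  rw [← Ioc_union_Ioi_eq_Ioi hz.le, setIntegral_union Ioc_disjoint_Ioi_same measurableSet_Ioi hl hr,
    integral_energyDensity_left hn hz hnz (apply_neg_of_mem_profileSpace hn hn') hl,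
    (integral_energyDensity_right hn hn' hnz hr).2]
  ring

/-- Separation of variables: the travel time evaluated along `n` has slope one. -/
lemma eq_wallProfile_left (hn : IsLocallyAC n) (hz : -ℓ < z) (hnz : n z = 0)
    (h : ∀ᵐ y, y ∈ Ioc (-ℓ) z → deriv n y = speed (level (ℓ + z)) (n y)) {y : ℝ}
    (hy : y ∈ Icc (-ℓ) z) : n y = wallProfile ℓ z y := by
  have h1 := (hn y z).integral_comp_mul_deriv (hasDerivAt_travel_right 1 (level (ℓ + z)))
    (continuous_speed_pow_inv continuous_const continuous_id 1)
  have h2 : ∫ x in y..z, (speed (level (ℓ + z)) (n x) ^ 1)⁻¹ * deriv n x =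
      ∫ _ in y..z, (1 : ℝ) := by
    refine intervalIntegral.integral_congr_ae ?_
    filter_upwards [h] with x hx hx'
    rw [uIoc_of_le hy.2] at hx'
    rw [hx ⟨hy.1.trans_lt hx'.1, hx'.2⟩, pow_one, inv_mul_cancel₀ (speed_pos _ _).ne']
  rw [h2, intervalIntegral.integral_const, smul_eq_mul, mul_one, hnz, travel_zero] at h1
  have h3 : travel 1 (level (ℓ + z)) (-n y) = z - y := by
    have : travel 1 (level (ℓ + z)) (-n y) = -travel 1 (level (ℓ + z)) (n y) := by
      have := intervalIntegral.integral_comp_neg (a := 0) (b := n y)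
        (fun s => (speed (level (ℓ + z)) s ^ 1)⁻¹)
      simp only [speed_neg, neg_zero] at this
      unfold travel
      rw [this, intervalIntegral.integral_symm]
    linarith
  rw [wallProfile_of_mem hz hy, ← h3, orbit_travel, neg_neg]

/-- Here `1 - u²` has zeros, so variables are not separated. Instead `d = n - tanh (· - z)` solves
the linear equation `d' = -(n + tanh (· - z)) d` with `d z = 0`, and `exp P` is an integrating
factor. -/
lemma eq_wallProfile_right (hn : IsLocallyAC n) (hz : -ℓ < z) (hnz : n z = 0)
    (h : ∀ᵐ y, y ∈ Ioi z → deriv n y = 1 - n y ^ 2) {y : ℝ} (hy : z ≤ y) :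
    n y = wallProfile ℓ z y := by
  have hτ (x : ℝ) : HasDerivAt (fun y => Real.tanh (y - z)) (1 - Real.tanh (x - z) ^ 2) x :=
    (hasDerivAt_tanh (x - z)).comp_sub_const x z
  have hτc : Continuous fun y => Real.tanh (y - z) :=
    continuous_tanh.comp (continuous_id.sub continuous_const)
  have hs : Continuous fun y => n y + Real.tanh (y - z) := hn.continuous.add hτc
  set P : ℝ → ℝ := fun y => ∫ x in z..y, (n x + Real.tanh (x - z)) with hP
  have hPd (x : ℝ) : HasDerivAt P (n x + Real.tanh (x - z)) x :=
    intervalIntegral.integral_hasDerivAt_right (hs.intervalIntegrable _ _)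
      (hs.stronglyMeasurableAtFilter _ _) hs.continuousAt
  have hPc : Continuous P := continuous_iff_continuousAt.2 fun x => (hPd x).continuousAt
  have hA1 : AbsolutelyContinuousOnInterval (fun x => Real.exp (P x)) z y :=
    (contDiff_one_of_hasDerivAt (fun x => (hPd x).exp)
      ((Real.continuous_exp.comp hPc).mul hs)).contDiffOn.absolutelyContinuousOnInterval
  have hA2 : AbsolutelyContinuousOnInterval (fun y => Real.tanh (y - z)) z y :=
    (contDiff_one_of_hasDerivAt hτ
      (continuous_const.sub (hτc.pow 2))).contDiffOn.absolutelyContinuousOnInterval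
  obtain ⟨C, hC⟩ := (((hn z y).fun_sub hA2).fun_mul hA1).const_of_ae_hasDerivAt_zero (by
    have hne : ∀ᵐ x : ℝ, x ≠ z := by simp [ae_iff]
    filter_upwards [h, (hn z y).ae_differentiableAt, hne] with x hx1 hx2 hx3 hx4
    have hx5 := (hx2 hx4).hasDerivAt
    rw [uIcc_of_le hy] at hx4
    rw [hx1 (lt_of_le_of_ne hx4.1 hx3.symm)] at hx5
    refine ((hx5.sub (hτ x)).mul (hPd x).exp).congr_deriv ?_
    simp only [Pi.sub_apply]
    ring)
  have h0 := hC z left_mem_uIcc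
  have h1 := hC y right_mem_uIcc
  rw [hnz, sub_self, Real.tanh_zero, sub_zero, zero_mul] at h0
  rw [← h0, mul_eq_zero, or_iff_left (Real.exp_pos _).ne'] at h1
  rw [wallProfile_of_ge hz hy]
  linarith

lemma integrableOn_energyDensity_wallProfile (hz : -ℓ < z) :
    IntegrableOn (energyDensity (wallProfile ℓ z)) (Ioi (-ℓ)) := by
  have hm := measurable_energyDensity (isLocallyAC_wallProfile hz)
  rw [← Ioc_union_Ioi_eq_Ioi hz.le]
  refine IntegrableOn.union ?_ ?_
  · rw [integrableOn_Ioc_iff_integrableOn_Ioo]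
    have hc : ContinuousOn (fun y => speed (level (ℓ + z)) (wallProfile ℓ z y) ^ 2 +
        doubleWell (wallProfile ℓ z y)) (Icc (-ℓ) z) := by
      have h1 := continuous_wallProfile hz
      refine (((continuous_speed_comp continuous_const h1).pow 2).add ?_).continuousOn
      unfold doubleWell
      fun_prop
    refine ((hc.integrableOn_Icc).mono_set Ioo_subset_Icc_self).congr_fun (fun y hy => ?_)
      measurableSet_Ioo
    rw [energyDensity, (hasDerivAt_wallProfile_of_mem hy).deriv]
  · have h4 : IntegrableOn (fun y => 32 * Real.exp (4 * z) * Real.exp (-4 * y)) (Ioi z) :=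
      (integrableOn_exp_mul_Ioi (by norm_num) z).const_mul _
    refine h4.mono' hm.aestronglyMeasurable ?_
    refine (ae_restrict_iff' measurableSet_Ioi).2 (Eventually.of_forall fun y hy => ?_)
    have hy : z < y := hy
    rw [Real.norm_of_nonneg (energyDensity_nonneg _ _), energyDensity,
      (hasDerivAt_wallProfile_of_gt hz hy).deriv, wallProfile_of_ge hz hy.le, doubleWell]
    have h5 := one_sub_tanh_le (y - z)
    have h6 := Real.tanh_lt_one (y - z)
    have h7 := tanh_nonneg (sub_nonneg.2 hy.le)
    have h8 : 0 ≤ 1 - Real.tanh (y - z) := by linarith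
    calc (1 - Real.tanh (y - z) ^ 2) ^ 2 + (Real.tanh (y - z) ^ 2 - 1) ^ 2
        = 2 * ((1 - Real.tanh (y - z)) * (1 + Real.tanh (y - z))) ^ 2 := by ring
      _ ≤ 2 * ((2 * Real.exp (-2 * (y - z))) * (1 + 1)) ^ 2 := by gcongr
      _ = 32 * (Real.exp (-2 * (y - z))) ^ 2 := by ring
      _ = _ := by
        rw [← Real.exp_nat_mul, mul_assoc, ← Real.exp_add]
        norm_num
        ring

lemma integral_energyDensity_wallProfile (hz : -ℓ < z) :
    ∫ y in Ioi (-ℓ), energyDensity (wallProfile ℓ z) y = wallEnergy ℓ z + 4 / 3 := by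
  rw [integral_energyDensity (isLocallyAC_wallProfile hz) (wallProfile_mem_profileSpace hz) hz
    (wallProfile_apply_self hz) (integrableOn_energyDensity_wallProfile hz)]
  have h1 : ∫ y in Ioc (-ℓ) z, (deriv (wallProfile ℓ z) y -
      speed (level (ℓ + z)) (wallProfile ℓ z y)) ^ 2 = 0 := by
    rw [integral_Ioc_eq_integral_Ioo]
    refine setIntegral_eq_zero_of_forall_eq_zero fun y hy => ?_
    rw [(hasDerivAt_wallProfile_of_mem hy).deriv, sub_self, zero_pow two_ne_zero]
  have h2 : ∫ y in Ioi z, (deriv (wallProfile ℓ z) y - (1 - wallProfile ℓ z y ^ 2)) ^ 2 = 0 := by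
    refine setIntegral_eq_zero_of_forall_eq_zero fun y hy => ?_
    rw [(hasDerivAt_wallProfile_of_gt hz hy).deriv, wallProfile_of_ge hz (le_of_lt hy), sub_self,
      zero_pow two_ne_zero]
  rw [h1, h2, add_zero, add_zero]

lemma profileEnergy_eq (hn : IsLocallyAC n) (hn' : n ∈ profileSpace ℓ)
    (h : IntegrableOn (energyDensity n) (Ioi (-ℓ))) :
    profileEnergy ℓ n = ENNReal.ofReal (∫ y in Ioi (-ℓ), energyDensity n y) := by
  rw [profileEnergy, if_pos ⟨hn', hn⟩,
    ofReal_integral_eq_lintegral_ofReal h (Eventually.of_forall (energyDensity_nonneg n))]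
  rfl

lemma of_profileEnergy_ne_top (h : profileEnergy ℓ n ≠ ⊤) :
    IsLocallyAC n ∧ n ∈ profileSpace ℓ ∧ IntegrableOn (energyDensity n) (Ioi (-ℓ)) := by
  unfold profileEnergy at h
  split_ifs at h with h1
  · refine ⟨h1.2, h1.1, (measurable_energyDensity h1.2).aestronglyMeasurable, ?_⟩
    rw [hasFiniteIntegral_iff_ofReal (Eventually.of_forall (energyDensity_nonneg n))]
    exact lt_top_iff_ne_top.2 h
  · exact absurd rfl h

lemma isConstrainedMinimizer_wallProfile (hz : -ℓ < z) :
    IsConstrainedMinimizer ℓ z (wallProfile ℓ z) := by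
  refine ⟨⟨wallProfile_mem_profileSpace hz, wallProfile_apply_self hz⟩, fun n _ hnz => ?_⟩
  by_cases h : profileEnergy ℓ n = ⊤
  · rw [h]; exact le_top
  obtain ⟨h1, h2, h3⟩ := of_profileEnergy_ne_top h
  rw [profileEnergy_eq h1 h2 h3, profileEnergy_eq (isLocallyAC_wallProfile hz)
    (wallProfile_mem_profileSpace hz) (integrableOn_energyDensity_wallProfile hz),
    integral_energyDensity_wallProfile hz, integral_energyDensity h1 h2 hz hnz h3]
  refine ENNReal.ofReal_le_ofReal ?_
  have h4 : 0 ≤ ∫ y in Ioc (-ℓ) z, (deriv n y - speed (level (ℓ + z)) (n y)) ^ 2 :=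
    integral_nonneg fun y => sq_nonneg _
  have h5 : 0 ≤ ∫ y in Ioi z, (deriv n y - (1 - n y ^ 2)) ^ 2 :=
    integral_nonneg fun y => sq_nonneg _
  linarith

/-- Equality of energies forces both integrated squares to vanish, so the first-order equations hold
almost everywhere. -/
lemma IsConstrainedMinimizer.eq_wallProfile (hz : -ℓ < z) (hn : IsConstrainedMinimizer ℓ z n) :
    n = wallProfile ℓ z := by
  have hm := wallProfile_mem_profileSpace hz
  have hmE := profileEnergy_eq (isLocallyAC_wallProfile hz) hm
    (integrableOn_energyDensity_wallProfile hz)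
  have hle := hn.2 _ hm (wallProfile_apply_self hz)
  obtain ⟨h1, h2, h3⟩ := of_profileEnergy_ne_top (ℓ := ℓ) (n := n)
    (ne_top_of_le_ne_top (by rw [hmE]; exact ENNReal.ofReal_ne_top) hle)
  rw [hmE, profileEnergy_eq h1 h2 h3, ENNReal.ofReal_le_ofReal_iff
    (integral_nonneg (energyDensity_nonneg _)), integral_energyDensity_wallProfile hz,
    integral_energyDensity h1 h2 hz hn.1.2 h3] at hle
  have hr := (integral_energyDensity_right h1 h2 hn.1.2 (h3.mono_set (Ioi_subset_Ioi hz.le))).1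
  have h4 : 0 ≤ ∫ y in Ioc (-ℓ) z, (deriv n y - speed (level (ℓ + z)) (n y)) ^ 2 :=
    integral_nonneg fun y => sq_nonneg _
  have h5 : 0 ≤ ∫ y in Ioi z, (deriv n y - (1 - n y ^ 2)) ^ 2 :=
    integral_nonneg fun y => sq_nonneg _
  have hl : IntegrableOn (fun y => (deriv n y - speed (level (ℓ + z)) (n y)) ^ 2) (Ioc (-ℓ) z) := by
    have hc := continuous_speed_comp (continuous_const (y := level (ℓ + z))) h1.continuous
    have hd := integrableOn_deriv_sq (h3.mono_set (Ioc_subset_Ioi_self : Ioc (-ℓ) z ⊆ _))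
    have h6 := (hd.const_mul 2).add
      (((hc.pow 2).integrableOn_Icc (a := -ℓ) (b := z) (μ := volume)).mono_set
        Ioc_subset_Icc_self |>.const_mul 2)
    have := measurable_deriv n
    have := hc.measurable
    refine h6.mono' (by fun_prop) (Eventually.of_forall fun y => ?_)
    rw [Real.norm_of_nonneg (sq_nonneg _)]
    simp only [Pi.add_apply, Pi.pow_apply]
    nlinarith [sq_nonneg (deriv n y + speed (level (ℓ + z)) (n y))]
  have h6 : ∀ᵐ y, y ∈ Ioc (-ℓ) z → deriv n y = speed (level (ℓ + z)) (n y) := by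
    have h7 := (setIntegral_eq_zero_iff_of_nonneg_ae (Eventually.of_forall fun y => sq_nonneg _)
      hl).1 (le_antisymm (by linarith) h4)
    rw [Filter.EventuallyEq, ae_restrict_iff' measurableSet_Ioc] at h7
    filter_upwards [h7] with y hy hy'
    exact sub_eq_zero.1 (pow_eq_zero_iff two_ne_zero |>.1 (hy hy'))
  have h7 : ∀ᵐ y, y ∈ Ioi z → deriv n y = 1 - n y ^ 2 := by
    have h7 := (setIntegral_eq_zero_iff_of_nonneg_ae (Eventually.of_forall fun y => sq_nonneg _)
      hr).1 (le_antisymm (by linarith) h5)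
    rw [Filter.EventuallyEq, ae_restrict_iff' measurableSet_Ioi] at h7
    filter_upwards [h7] with y hy hy'
    exact sub_eq_zero.1 (pow_eq_zero_iff two_ne_zero |>.1 (hy hy'))
  funext y
  rcases lt_or_ge y (-ℓ) with hy | hy
  · rw [h2.2 y hy, wallProfile_of_le hy.le]
  rcases le_total y z with hy' | hy'
  · exact eq_wallProfile_left h1 hz hn.1.2 h6 ⟨hy, hy'⟩
  · exact eq_wallProfile_right h1 hz hn.1.2 h7 hy'

lemma constrainedMin_eq (hz : -ℓ < z) : constrainedMin ℓ z = wallProfile ℓ z :=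
  IsConstrainedMinimizer.eq_wallProfile hz
    (Classical.epsilon_spec ⟨_, isConstrainedMinimizer_wallProfile hz⟩)

end Energy

/-! ### Derivatives of the minimizer in both variables, and the jumps at the zero. -/

section Derivatives

variable {ℓ y z : ℝ}

lemma eventually_constrainedMin_eq_left (hy : -ℓ < y) (hz : y < z) :
    (fun w => constrainedMin ℓ w y) =ᶠ[𝓝 z] fun w => -orbit (level (ℓ + w)) (w - y) := by
  filter_upwards [lt_mem_nhds hz] with w hw
  rw [constrainedMin_eq (hy.trans hw), wallProfile_of_mem (hy.trans hw) ⟨hy.le, hw.le⟩]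

lemma hasDerivAt_constrainedMin_left (hy : -ℓ < y) (hz : y < z) :
    HasDerivAt (fun w => constrainedMin ℓ w y)
      (-(speed (level (ℓ + z)) (orbit (level (ℓ + z)) (z - y)) *
        wallFactor (level (ℓ + z)) (orbit (level (ℓ + z)) (z - y)))) z :=
  (hasDerivAt_orbit_level hy hz).neg.congr_of_eventuallyEq
    (eventually_constrainedMin_eq_left hy hz)

lemma hasDerivAt_deriv_constrainedMin_left (hy : -ℓ < y) (hz : y < z) :
    HasDerivAt (deriv fun w => constrainedMin ℓ w y)
      (-orbitSecondDeriv (level (ℓ + z)) (orbit (level (ℓ + z)) (z - y))) z := by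
  refine (hasDerivAt_deriv_orbit_level hy hz).neg.congr_of_eventuallyEq ?_
  filter_upwards [lt_mem_nhds hz] with w hw using (hasDerivAt_constrainedMin_left hy hw).deriv

lemma twiceDifferentiableAt_constrainedMin (hy : -ℓ < y) (hz : y < z) :
    TwiceDifferentiableAt (fun w => constrainedMin ℓ w y) z := by
  refine ⟨?_, (hasDerivAt_deriv_constrainedMin_left hy hz).differentiableAt⟩
  filter_upwards [lt_mem_nhds hz] with w hw
    using (hasDerivAt_constrainedMin_left hy hw).differentiableAt

lemma hasDerivAt_constrainedMin_right (hz : -ℓ < z) (hy : z < y) :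
    HasDerivAt (fun w => constrainedMin ℓ w y) (-(1 - Real.tanh (y - z) ^ 2)) z := by
  refine ((hasDerivAt_tanh (y - z)).comp_const_sub y z).congr_of_eventuallyEq ?_
  filter_upwards [gt_mem_nhds hy, lt_mem_nhds hz] with w hw hw'
  rw [constrainedMin_eq hw', wallProfile_of_ge hw' hw.le]

lemma deriv_instanton (z : ℝ) : deriv (instanton z) = fun y => 1 - Real.tanh (y - z) ^ 2 :=
  funext fun y => ((hasDerivAt_tanh (y - z)).comp_sub_const y z).deriv

lemma deriv_deriv_instanton (z y : ℝ) :
    deriv (deriv (instanton z)) y = -2 * Real.tanh (y - z) * (1 - Real.tanh (y - z) ^ 2) := by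
  rw [deriv_instanton]
  refine ((((hasDerivAt_tanh (y - z)).comp_sub_const y z).pow 2).const_sub 1).deriv.trans ?_
  simp

lemma abs_constrainedMin_sub_instanton_le (hy : y ∈ Ioo (-ℓ) z) :
    |constrainedMin ℓ z y - instanton z y| ≤ Real.exp (level (ℓ + z) / 2) := by
  have hz := hy.1.trans hy.2
  rw [constrainedMin_eq hz, wallProfile_of_mem hz (Ioo_subset_Icc_self hy), instanton,
    ← neg_sub z y, Real.tanh_neg, neg_sub_neg, abs_sub_comm]
  exact abs_orbit_sub_tanh_le (sub_mem_time hz (Ioo_subset_Icc_self hy))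

lemma abs_deriv_constrainedMin_add_le (hL : 1 ≤ ℓ + z) (hy : y ∈ Ioo (-ℓ) z) :
    |deriv (fun w => constrainedMin ℓ w y) z + deriv (instanton z) y| ≤
      400 * Real.exp (level (ℓ + z) / 2) := by
  have hm := sub_mem_time (hy.1.trans hy.2) (Ioo_subset_Icc_self hy)
  have hu := orbit_mem hm
  rw [(hasDerivAt_constrainedMin_left hy.1 hy.2).deriv, congrFun (deriv_instanton z) y, ← neg_sub z y,
    Real.tanh_neg, neg_sq, ← sub_eq_neg_add, abs_sub_comm]
  exact abs_speed_mul_wallFactor_sub_le (exp_half_level_le_one hL) hu.1 hu.2 (tanh_nonneg hm.1)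
    (Real.tanh_lt_one _).le (abs_orbit_sub_tanh_le hm)

lemma abs_deriv_deriv_constrainedMin_sub_le (hL : 1 ≤ ℓ + z) (hy : y ∈ Ioo (-ℓ) z) :
    |deriv (deriv fun w => constrainedMin ℓ w y) z - deriv (deriv (instanton z)) y| ≤
      20000000 * Real.exp (level (ℓ + z) / 2) := by
  have hm := sub_mem_time (hy.1.trans hy.2) (Ioo_subset_Icc_self hy)
  have hu := orbit_mem hm
  have h := abs_orbitSecondDeriv_add_le (exp_half_level_le_one hL) hu.1 hu.2 (tanh_nonneg hm.1)
    (Real.tanh_lt_one _).le (abs_orbit_sub_tanh_le hm)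
  rw [(hasDerivAt_deriv_constrainedMin_left hy.1 hy.2).deriv, deriv_deriv_instanton, ← neg_sub z y,
    Real.tanh_neg, ← abs_neg]
  refine (congrArg _ ?_).trans_le h
  ring

lemma differentiableAt_constrainedMin (hz : -ℓ < z) (hy : -ℓ < y) (hyz : y ≠ z) :
    DifferentiableAt ℝ (constrainedMin ℓ z) y ∧
      DifferentiableAt ℝ (fun w => constrainedMin ℓ w y) z := by
  rw [constrainedMin_eq hz]
  rcases hyz.lt_or_gt with h | h
  · exact ⟨(hasDerivAt_wallProfile_of_mem ⟨hy, h⟩).differentiableAt,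
      (hasDerivAt_constrainedMin_left hy h).differentiableAt⟩
  · exact ⟨(hasDerivAt_wallProfile_of_gt hz h).differentiableAt,
      (hasDerivAt_constrainedMin_right hz h).differentiableAt⟩

lemma tendsto_one_sub_tanh_sq (z : ℝ) :
    Tendsto (fun y => 1 - Real.tanh (y - z) ^ 2) (𝓝[>] z) (𝓝 1) := by
  have h : Continuous fun y => 1 - Real.tanh (y - z) ^ 2 :=
    continuous_const.sub ((continuous_tanh.comp (continuous_id.sub continuous_const)).pow 2)
  have := h.tendsto z
  rw [sub_self, Real.tanh_zero, zero_pow two_ne_zero, sub_zero] at this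
  exact this.mono_left inf_le_left

lemma hasJump_deriv_constrainedMin (hz : -ℓ < z) :
    HasJump (deriv (constrainedMin ℓ z)) z (1 - speed (level (ℓ + z)) 0) := by
  rw [constrainedMin_eq hz]
  refine ⟨_, _, ?_, ?_, rfl⟩
  · have := (continuous_speed_comp (continuous_const (y := level (ℓ + z)))
      (continuous_wallProfile hz)).tendsto z
    rw [wallProfile_apply_self hz] at this
    refine (this.mono_left inf_le_left).congr' ?_
    filter_upwards [Ioo_mem_nhdsLT hz] with y hy using (hasDerivAt_wallProfile_of_mem hy).deriv.symm
  · refine (tendsto_one_sub_tanh_sq z).congr' ?_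
    filter_upwards [self_mem_nhdsWithin] with y hy
      using (hasDerivAt_wallProfile_of_gt hz hy).deriv.symm

/-- The wall factor is `1` at height `0`, so on each side of `z` the limit of the `z`-derivative is
minus that of the slope; hence the two jumps cancel. -/
lemma hasJump_deriv_left_constrainedMin (hz : -ℓ < z) :
    HasJump (fun y => deriv (fun w => constrainedMin ℓ w y) z) z
      (-1 - -speed (level (ℓ + z)) 0) := by
  refine ⟨_, _, ?_, ?_, rfl⟩
  · have hw : Continuous fun y => -(speed (level (ℓ + z)) (-wallProfile ℓ z y) *
        wallFactor (level (ℓ + z)) (-wallProfile ℓ z y)) := by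
      have hn := (continuous_wallProfile hz).neg
      exact ((continuous_speed_comp continuous_const hn).mul
        (continuous_const.sub ((continuous_travel continuous_const hn 3).div_const _))).neg
    have := hw.tendsto z
    simp only [wallProfile_apply_self hz, neg_zero, wallFactor, travel_zero,
      zero_div, sub_zero, mul_one] at this
    refine (this.mono_left inf_le_left).congr' ?_
    filter_upwards [Ioo_mem_nhdsLT hz] with y hy
    rw [(hasDerivAt_constrainedMin_left hy.1 hy.2).deriv,
      wallProfile_of_mem hz (Ioo_subset_Icc_self hy), neg_neg, wallFactor]
  · refine (tendsto_one_sub_tanh_sq z).neg.congr' ?_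
    filter_upwards [self_mem_nhdsWithin] with y hy
      using (hasDerivAt_constrainedMin_right hz hy).deriv.symm

lemma abs_one_sub_speed_zero_le (θ : ℝ) : |1 - speed θ 0| ≤ Real.exp (θ / 2) ^ 2 := by
  have h1 := one_sub_sq_le_speed θ 0
  have h2 := speed_sq θ 0
  rw [exp_half_sq, abs_sub_comm, abs_of_nonneg (by linarith)]
  nlinarith

end Derivatives

/-! ### Ordering of the profiles and the `L²` bounds. -/

section Comparison

variable {ℓ z₁ z₂ : ℝ}

lemma travel_sub_travel_anti {θ θ' a b : ℝ} (hθ : θ ≤ θ') (hab : a ≤ b) :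
    travel 1 θ' b - travel 1 θ' a ≤ travel 1 θ b - travel 1 θ a := by
  refine sub_le_sub_of_hasDerivAt_le hab (fun x _ => hasDerivAt_travel_right 1 θ' x)
    (fun x _ => hasDerivAt_travel_right 1 θ x) fun x _ => ?_
  rw [pow_one, pow_one]
  refine inv_anti₀ (speed_pos θ x) (Real.sqrt_le_sqrt ?_)
  gcongr

/-- A farther zero means a lower energy and a slower orbit. Left of `z₁` both orbits have the time
`y + ℓ` left before the wall, so the slower one must already be closer to height `1`. -/
lemma wallProfile_anti (h1 : -ℓ < z₁) (h : z₁ ≤ z₂) (y : ℝ) :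
    wallProfile ℓ z₂ y ≤ wallProfile ℓ z₁ y := by
  have h2 := h1.trans_le h
  rcases le_total y (-ℓ) with hy | hy
  · rw [wallProfile_of_le hy, wallProfile_of_le hy]
  rcases le_total y z₁ with hy1 | hy1
  · rw [wallProfile_of_mem h1 ⟨hy, hy1⟩, wallProfile_of_mem h2 ⟨hy, hy1.trans h⟩, neg_le_neg_iff]
    have hm1 := sub_mem_time h1 ⟨hy, hy1⟩
    have hm2 := sub_mem_time h2 ⟨hy, hy1.trans h⟩
    have e1 := travel_orbit hm1
    have e2 := travel_orbit hm2
    have f1 := travel_level (L := ℓ + z₁) (by linarith)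
    have f2 := travel_level (L := ℓ + z₂) (by linarith)
    by_contra! hlt
    have g1 := travel_strictMono 1 (level (ℓ + z₂)) hlt
    have g2 := travel_sub_travel_anti (level_anti (L := ℓ + z₁) (L' := ℓ + z₂) (by linarith)
      (by linarith)) (orbit_mem hm1).2
    linarith
  rcases le_total y z₂ with hy2 | hy2
  · rw [wallProfile_of_ge h1 hy1]
    exact (wallProfile_mem h2 ⟨hy, hy2⟩).2.trans (tanh_nonneg (sub_nonneg.2 hy1))
  · rw [wallProfile_of_ge h1 hy1, wallProfile_of_ge h2 hy2]
    exact tanh_strictMono.monotone (by linarith)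

/-- With the zeros aligned, the slower orbit lags behind at equal times from its zero. -/
lemma wallProfile_sub_le (h1 : -ℓ < z₁) (h : z₁ ≤ z₂) (y : ℝ) :
    wallProfile ℓ z₁ (y - (z₂ - z₁)) ≤ wallProfile ℓ z₂ y := by
  have h2 := h1.trans_le h
  rcases le_total (y - (z₂ - z₁)) (-ℓ) with hy | hy
  · rw [wallProfile_of_le hy]
    exact (abs_le.1 (abs_wallProfile_le_one h2)).1
  rcases le_total y z₂ with hy2 | hy2
  · have hm1 : y - (z₂ - z₁) ∈ Icc (-ℓ) z₁ := ⟨hy, by linarith⟩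
    have hm2 : y ∈ Icc (-ℓ) z₂ := ⟨by linarith, hy2⟩
    rw [wallProfile_of_mem h1 hm1, wallProfile_of_mem h2 hm2, neg_le_neg_iff]
    have e1 := travel_orbit (sub_mem_time h1 hm1)
    have e2 := travel_orbit (sub_mem_time h2 hm2)
    by_contra! hlt
    have g1 := travel_strictMono 1 (level (ℓ + z₂)) hlt
    have g2 := travel_sub_travel_anti (level_anti (L := ℓ + z₁) (L' := ℓ + z₂) (by linarith)
      (by linarith)) (orbit_mem (sub_mem_time h1 hm1)).1
    rw [travel_zero, travel_zero] at g2
    linarith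
  · rw [wallProfile_of_ge h1 (by linarith), wallProfile_of_ge h2 hy2]
    exact tanh_strictMono.monotone (by linarith)

/-- Over `[a, b]` the integral telescopes to integrals of `f` over two intervals of length `h`. As
the integrand is nonnegative, this uniform bound also yields integrability. -/
lemma integrable_sub_shift {f : ℝ → ℝ} (hf : Continuous f) (hm : Monotone f) (hb : ∀ x, |f x| ≤ 1)
    {h : ℝ} (hh : 0 ≤ h) :
    Integrable (fun y => f y - f (y - h)) ∧ ∫ y, (f y - f (y - h)) ≤ 2 * h := by
  have hc : Continuous fun y => f y - f (y - h) := by fun_prop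
  have hi (a b : ℝ) : IntervalIntegrable f volume a b := hf.intervalIntegrable a b
  have hbound (a b : ℝ) : ∫ y in a..b, (f y - f (y - h)) ≤ 2 * h := by
    rw [intervalIntegral.integral_sub (hi a b)
      (Continuous.intervalIntegrable (by fun_prop) a b),
      intervalIntegral.integral_comp_sub_right]
    have h1 : (∫ x in a..b, f x) - ∫ x in (a - h)..(b - h), f x =
        (∫ x in (b - h)..b, f x) - ∫ x in (a - h)..a, f x := by
      have := intervalIntegral.integral_add_adjacent_intervals (hi (a - h) a) (hi a b)
      have := intervalIntegral.integral_add_adjacent_intervals (hi (a - h) (b - h)) (hi (b - h) b)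
      linarith
    have h2 (c : ℝ) : |∫ x in (c - h)..c, f x| ≤ h := by
      have := intervalIntegral.norm_integral_le_of_norm_le_const (a := c - h) (b := c) (f := f)
        (C := 1) fun x _ => hb x
      rwa [sub_sub_cancel, abs_of_nonneg hh, one_mul] at this
    rw [h1]
    linarith [abs_le.1 (h2 a), abs_le.1 (h2 b)]
  have hint : Integrable (fun y => f y - f (y - h)) := by
    refine integrable_of_intervalIntegral_norm_bounded (2 * h) (a := fun n : ℕ => -(n : ℝ))
      (b := fun n : ℕ => (n : ℝ)) (fun n => hc.integrableOn_Ioc)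
      (tendsto_neg_atTop_atBot.comp tendsto_natCast_atTop_atTop) tendsto_natCast_atTop_atTop
      (Eventually.of_forall fun n => ?_)
    refine le_of_eq_of_le (intervalIntegral.integral_congr fun y _ => ?_) (hbound _ _)
    exact Real.norm_of_nonneg (sub_nonneg.2 (hm (sub_le_self y hh)))
  refine ⟨hint, le_of_tendsto' (intervalIntegral_tendsto_integral hint tendsto_neg_atTop_atBot
    tendsto_id) fun b => hbound _ _⟩

/-- One factor of the square is kept as the gap to the translate; the other is bounded by `2` or,
the Lipschitz constant `1 + ε` being at most `2`, by twice the shift. -/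
lemma sq_wallProfile_sub_le (h1 : 1 ≤ ℓ + z₁) (h : z₁ ≤ z₂) (y : ℝ) :
    (wallProfile ℓ z₁ y - wallProfile ℓ z₂ y) ^ 2 ≤
      2 * min 1 (z₂ - z₁) * (wallProfile ℓ z₁ y - wallProfile ℓ z₁ (y - (z₂ - z₁))) := by
  have hz : -ℓ < z₁ := by linarith
  have h2 := wallProfile_anti hz h y
  have h3 := wallProfile_sub_le hz h y
  have h4 := abs_le.1 (abs_wallProfile_le_one hz (y := y))
  have h5 := abs_le.1 (abs_wallProfile_le_one hz (y := y - (z₂ - z₁)))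
  have h6 := (wallProfile_lipschitz_of_le hz (sub_le_self y (sub_nonneg.2 h))).2
  have h7 := exp_half_level_le_one h1
  have h8 : wallProfile ℓ z₁ y - wallProfile ℓ z₁ (y - (z₂ - z₁)) ≤ 2 * min 1 (z₂ - z₁) := by
    rw [mul_min_of_nonneg _ _ two_pos.le]
    refine le_min (by linarith) (h6.trans ?_)
    rw [sub_sub_cancel]
    gcongr
    linarith
  rw [sq]
  gcongr
  · linarith

lemma toReal_eLpNorm_two_sq {f : ℝ → ℝ} (hf : MemLp f 2 volume) :
    (eLpNorm f 2 volume).toReal ^ 2 = ∫ y, f y ^ 2 := by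
  rw [hf.eLpNorm_eq_integral_rpow_norm two_ne_zero ENNReal.ofNat_ne_top,
    ENNReal.toReal_ofReal (by positivity), ← Real.rpow_natCast, ← Real.rpow_mul
    (integral_nonneg fun y => by positivity)]
  simp

lemma memLp_wallProfile_sub (h1 : 1 ≤ ℓ + z₁) (h : z₁ ≤ z₂) :
    MemLp (wallProfile ℓ z₁ - wallProfile ℓ z₂) 2 volume ∧
      ∫ y, (wallProfile ℓ z₁ y - wallProfile ℓ z₂ y) ^ 2 ≤
        4 * min ((z₂ - z₁) ^ 2) (z₂ - z₁) := by
  have hz : -ℓ < z₁ := by linarith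
  have hc := (continuous_wallProfile hz).sub (continuous_wallProfile (hz.trans_le h))
  obtain ⟨hi, hle⟩ := integrable_sub_shift (continuous_wallProfile hz) (monotone_wallProfile hz)
    (fun _ => abs_wallProfile_le_one hz) (sub_nonneg.2 h)
  have hb := sq_wallProfile_sub_le h1 h
  have hint : Integrable fun y => (wallProfile ℓ z₁ y - wallProfile ℓ z₂ y) ^ 2 := by
    refine (hi.const_mul (2 * min 1 (z₂ - z₁))).mono' (hc.pow 2).aestronglyMeasurable
      (Eventually.of_forall fun y => ?_)
    rw [Real.norm_of_nonneg (sq_nonneg _)]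
    exact hb y
  refine ⟨(memLp_two_iff_integrable_sq hc.aestronglyMeasurable).2 hint, ?_⟩
  have h0 : 0 ≤ z₂ - z₁ := sub_nonneg.2 h
  calc ∫ y, (wallProfile ℓ z₁ y - wallProfile ℓ z₂ y) ^ 2
      ≤ ∫ y, 2 * min 1 (z₂ - z₁) *
          (wallProfile ℓ z₁ y - wallProfile ℓ z₁ (y - (z₂ - z₁))) :=
        integral_mono hint (hi.const_mul _) hb
    _ ≤ 2 * min 1 (z₂ - z₁) * (2 * (z₂ - z₁)) := by
        rw [integral_const_mul]
        have : 0 ≤ min 1 (z₂ - z₁) := le_min zero_le_one h0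
        gcongr
    _ = 4 * (min 1 (z₂ - z₁) * (z₂ - z₁)) := by ring
    _ = 4 * min ((z₂ - z₁) ^ 2) (z₂ - z₁) := by
        rw [min_mul_of_nonneg _ _ h0, one_mul, ← sq, min_comm]

lemma mul_sub_le_integral_sq {f : ℝ → ℝ} (hf : MemLp f 2 volume) {a b c : ℝ} (hab : a ≤ b)
    (h : ∀ y ∈ Icc a b, c ≤ f y ^ 2) : c * (b - a) ≤ ∫ y, f y ^ 2 := by
  have hi := hf.integrable_sq
  calc c * (b - a) = ∫ _ in Icc a b, c := by
        simp [hab, mul_comm]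
    _ ≤ ∫ y in Icc a b, f y ^ 2 :=
        setIntegral_mono_on (integrable_const c) hi.integrableOn measurableSet_Icc h
    _ ≤ ∫ y, f y ^ 2 := setIntegral_le_integral hi (Eventually.of_forall fun y => sq_nonneg _)

/-- For a shift at most `1`, both profiles on `[z₂, z₂ + 1]` are `tanh` with arguments in `[0, 2]`,
where the slope is at least `1 - tanh² 2`. For a larger shift, on `[z₁ + 1/2, z₂]` one profile is at
least `tanh (1/2)` and the other nonpositive, and this interval has at least half the length of the
shift. -/
lemma le_integral_wallProfile_sub_sq (h1 : 1 ≤ ℓ + z₁) (h : z₁ ≤ z₂) :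
    min ((1 - Real.tanh 2 ^ 2) ^ 2) (Real.tanh (1 / 2) ^ 2 / 2) * min ((z₂ - z₁) ^ 2) (z₂ - z₁) ≤
      ∫ y, (wallProfile ℓ z₁ y - wallProfile ℓ z₂ y) ^ 2 := by
  have hz : -ℓ < z₁ := by linarith
  have hz2 := hz.trans_le h
  have hm := (memLp_wallProfile_sub h1 h).1
  have h0 : 0 ≤ z₂ - z₁ := sub_nonneg.2 h
  rcases le_total (z₂ - z₁) 1 with h2 | h2
  · have h3 : ((1 - Real.tanh 2 ^ 2) * (z₂ - z₁)) ^ 2 * (z₂ + 1 - z₂) ≤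
        ∫ y, (wallProfile ℓ z₁ - wallProfile ℓ z₂) y ^ 2 := by
      refine mul_sub_le_integral_sq hm (by linarith) fun y hy => ?_
      have h4 : (1 - Real.tanh 2 ^ 2) * (y - z₁) - (1 - Real.tanh 2 ^ 2) * (y - z₂) ≤
          Real.tanh (y - z₁) - Real.tanh (y - z₂) := by
        refine sub_le_sub_of_hasDerivAt_le (by linarith)
          (fun x _ => (hasDerivAt_id x).const_mul (1 - Real.tanh 2 ^ 2))
          (fun x _ => hasDerivAt_tanh x) fun x hx => ?_
        have h5 := tanh_nonneg (x := x) (by linarith [hx.1, hy.1])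
        have h6 := tanh_strictMono.monotone (show x ≤ 2 by linarith [hx.2, hy.2])
        rw [mul_one]
        gcongr
      have h7 : 0 ≤ 1 - Real.tanh 2 ^ 2 := by linarith [Real.tanh_sq_lt_one 2]
      rw [Pi.sub_apply, wallProfile_of_ge hz (h.trans hy.1), wallProfile_of_ge hz2 hy.1]
      gcongr
      linarith
    calc _ ≤ (1 - Real.tanh 2 ^ 2) ^ 2 * (z₂ - z₁) ^ 2 := by
          gcongr
          · exact min_le_left _ _
          · exact min_le_left _ _
      _ = ((1 - Real.tanh 2 ^ 2) * (z₂ - z₁)) ^ 2 * (z₂ + 1 - z₂) := by ring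
      _ ≤ _ := h3
  · have h3 : Real.tanh (1 / 2) ^ 2 * (z₂ - (z₁ + 1 / 2)) ≤
        ∫ y, (wallProfile ℓ z₁ - wallProfile ℓ z₂) y ^ 2 := by
      refine mul_sub_le_integral_sq hm (by linarith) fun y hy => ?_
      have h4 := (wallProfile_mem hz2 (y := y) ⟨by linarith [hy.1], hy.2⟩).2
      have h5 := tanh_strictMono.monotone (show 1 / 2 ≤ y - z₁ by linarith [hy.1])
      have h6 := tanh_nonneg (x := 1 / 2) (by norm_num)
      rw [Pi.sub_apply, wallProfile_of_ge hz (by linarith [hy.1])]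
      gcongr
      linarith
    calc _ ≤ Real.tanh (1 / 2) ^ 2 / 2 * (z₂ - z₁) := by
          gcongr
          · exact min_le_right _ _
          · exact min_le_right _ _
      _ ≤ Real.tanh (1 / 2) ^ 2 * (z₂ - (z₁ + 1 / 2)) := by
        nlinarith [sq_nonneg (Real.tanh (1 / 2))]
      _ ≤ _ := h3

lemma norm_constrainedMin_sub_bounds {z₁ z₂ : ℝ} (h1 : 1 ≤ ℓ + z₁) (h2 : 1 ≤ ℓ + z₂) :
    MemLp (constrainedMin ℓ z₁ - constrainedMin ℓ z₂) 2 volume ∧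
      min ((1 - Real.tanh 2 ^ 2) ^ 2) (Real.tanh (1 / 2) ^ 2 / 2) *
          min (|z₁ - z₂| ^ 2) |z₁ - z₂| ≤
        (eLpNorm (constrainedMin ℓ z₁ - constrainedMin ℓ z₂) 2 volume).toReal ^ 2 ∧
      (eLpNorm (constrainedMin ℓ z₁ - constrainedMin ℓ z₂) 2 volume).toReal ^ 2 ≤
        4 * min (|z₁ - z₂| ^ 2) |z₁ - z₂| := by
  wlog h : z₁ ≤ z₂ generalizing z₁ z₂
  · have := this h2 h1 (le_of_not_ge h)
    rw [eLpNorm_sub_comm, abs_sub_comm, ← neg_sub (constrainedMin ℓ z₂)]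
    exact ⟨this.1.neg, this.2⟩
  rw [constrainedMin_eq (by linarith), constrainedMin_eq (by linarith), abs_sub_comm,
    abs_of_nonneg (sub_nonneg.2 h)]
  have hm := memLp_wallProfile_sub h1 h
  rw [toReal_eLpNorm_two_sq hm.1]
  exact ⟨hm.1, le_integral_wallProfile_sub_sq h1 h, hm.2⟩

end Comparison

/-! ### Assembly of the constants. -/

theorem mainTheorem3 :
    (∀ ℓ z : ℝ, 0 < ℓ → -ℓ < z → ∃! m : ℝ → ℝ, IsConstrainedMinimizer ℓ z m) ∧
    ∃ A : ℝ, 0 < A ∧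
      (∀ ℓ z : ℝ, 0 < ℓ → 1 ≤ ℓ + z →
        (∀ y ∈ Ioo (-ℓ) z,
          |constrainedMin ℓ z y - instanton z y| ≤ A * Real.exp (-2 * (ℓ + z))) ∧
        (∀ y ∈ Ioo (-ℓ) z,
          TwiceDifferentiableAt (fun w => constrainedMin ℓ w y) z ∧
          |deriv (fun w => constrainedMin ℓ w y) z + deriv (instanton z) y|
            ≤ A * Real.exp (-2 * (ℓ + z)) ∧
          |deriv (deriv (fun w => constrainedMin ℓ w y)) z - deriv (deriv (instanton z)) y|
            ≤ A * Real.exp (-2 * (ℓ + z))) ∧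
        (∀ y : ℝ, -ℓ < y → y ≠ z →
          DifferentiableAt ℝ (constrainedMin ℓ z) y ∧
          DifferentiableAt ℝ (fun w => constrainedMin ℓ w y) z) ∧
        (∃ j₁ j₂ : ℝ,
          HasJump (deriv (constrainedMin ℓ z)) z j₁ ∧
          HasJump (fun y => deriv (fun w => constrainedMin ℓ w y) z) z j₂ ∧
          j₁ + j₂ = 0 ∧
          |j₁| ≤ A * Real.exp (-4 * (ℓ + z)))) ∧
      (∀ ℓ z₁ z₂ : ℝ, 0 < ℓ → 1 ≤ min (z₁ + ℓ) (z₂ + ℓ) →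
        MemLp (constrainedMin ℓ z₁ - constrainedMin ℓ z₂) 2 volume ∧
        1 / A * min (|z₁ - z₂| ^ 2) |z₁ - z₂|
          ≤ (eLpNorm (constrainedMin ℓ z₁ - constrainedMin ℓ z₂) 2 volume).toReal ^ 2 ∧
        (eLpNorm (constrainedMin ℓ z₁ - constrainedMin ℓ z₂) 2 volume).toReal ^ 2
          ≤ A * min (|z₁ - z₂| ^ 2) |z₁ - z₂|) := by
  refine ⟨fun ℓ z _ hz => ⟨wallProfile ℓ z, isConstrainedMinimizer_wallProfile hz,
    fun n hn => hn.eq_wallProfile hz⟩, ?_⟩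
  set K : ℝ := 5 * Real.exp (4 / 3) with hK
  set κ : ℝ := min ((1 - Real.tanh 2 ^ 2) ^ 2) (Real.tanh (1 / 2) ^ 2 / 2) with hκ
  have hK0 : 0 < K := by positivity
  have hκ0 : 0 < κ := by
    have h1 : 0 < 1 - Real.tanh 2 ^ 2 := by linarith [Real.tanh_sq_lt_one 2]
    have h2 : 0 < Real.tanh (1 / 2) := by
      simpa using tanh_strictMono (show (0 : ℝ) < 1 / 2 by norm_num)
    exact lt_min (by positivity) (by positivity)
  have hκ1 : 0 < 1 / κ := by positivity
  -- The summands serve, in order, the three uniform bounds, the jump, and the upper and the lower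
  -- `L²` bound.
  refine ⟨20000000 * K + K ^ 2 + 4 + 1 / κ, by positivity, fun ℓ z _ hL => ?_,
    fun ℓ z₁ z₂ _ hL => ?_⟩
  · have hz : -ℓ < z := by linarith
    have hε := exp_half_level_le hL
    rw [← hK] at hε
    have hA {C : ℝ} (hC0 : 0 ≤ C) (hC : C ≤ 20000000) :
        C * Real.exp (level (ℓ + z) / 2) ≤
          (20000000 * K + K ^ 2 + 4 + 1 / κ) * Real.exp (-2 * (ℓ + z)) :=
      calc C * Real.exp (level (ℓ + z) / 2) ≤ 20000000 * (K * Real.exp (-2 * (ℓ + z))) := by gcongr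
        _ = (20000000 * K) * Real.exp (-2 * (ℓ + z)) := by ring
        _ ≤ _ := by gcongr; nlinarith
    refine ⟨fun y hy => ?_, fun y hy => ⟨twiceDifferentiableAt_constrainedMin hy.1 hy.2,
      (abs_deriv_constrainedMin_add_le hL hy).trans (hA (by norm_num) (by norm_num)),
      (abs_deriv_deriv_constrainedMin_sub_le hL hy).trans (hA (by norm_num) le_rfl)⟩,
      fun y => differentiableAt_constrainedMin hz, _, _, hasJump_deriv_constrainedMin hz,
      hasJump_deriv_left_constrainedMin hz, by ring, ?_⟩
    · have := hA zero_le_one (by norm_num)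
      rw [one_mul] at this
      exact (abs_constrainedMin_sub_instanton_le hy).trans this
    · calc |1 - speed (level (ℓ + z)) 0| ≤ Real.exp (level (ℓ + z) / 2) ^ 2 :=
            abs_one_sub_speed_zero_le _
        _ ≤ (K * Real.exp (-2 * (ℓ + z))) ^ 2 := by gcongr
        _ = K ^ 2 * Real.exp (-4 * (ℓ + z)) := by
            rw [mul_pow, ← Real.exp_nat_mul]; congr 2; push_cast; ring
        _ ≤ _ := by gcongr; nlinarith
  · obtain ⟨h1, h2⟩ := le_min_iff.1 hL
    obtain ⟨h3, h4, h5⟩ := norm_constrainedMin_sub_bounds (ℓ := ℓ) (z₁ := z₁) (z₂ := z₂)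
      (by linarith) (by linarith)
    refine ⟨h3, le_trans ?_ h4, h5.trans ?_⟩
    · gcongr
      rw [one_div_le (by positivity) hκ0]
      nlinarith
    · gcongr
      nlinarith
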